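/- A 2-complex is a combinatorial one: a graph (loops and multiple edges allowed) with 2-cells attached along closed edge paths, possibly constant or non-reduced. Its 1-skeleton carries the path metric with all edges of length $1$; a connected 2-complex is called $\delta$-hyperbolic ($\delta>0$) if its 1-skeleton is a $\delta$-hyperbolic geodesic space (every side of a geodesic triangle lies in the $\delta$-neighbourhood of the union of the other two). A cellular loop is a closed edge path, and its length is its number of edges. Chains are cellular, $\|\cdot\|$ is the $\ell^1$-norm with respect to the cells. For a finite 2-complex $M$ put $$\rho(M;\mathbb Z)=\inf_{0\ne z\in\partial C_2(M;\mathbb Z)}\frac{\|z\|}{\mathrm{Fill}_M(z;\mathbb Z)},\qquad \mathrm{Fill}_M(z;\mathbb Z)=\inf\{\|A\|: A\in C_2(M;\mathbb Z),\ \partial A=z\},$$ with the convention $\rho(M;\mathbb Z)=0$ if $H_1(M;\mathbb Q)\ne0$. Let $M$ be a finite connected 2-complex with universal cover $\widetilde M$ and torsion-free fundamental group $G$, acting on $\widetilde M$ by deck transformations. In 1 and 2, $g$ is a cellular loop in $M$ that is homotopically essential and of minimal length $L$ among all homotopically essential cellular loops of $M$, and $R=\lfloor (L-1)/4\rfloor$.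 Let $\tilde g$ be a lift of $g$ to a bi-infinite edge path in $\widetilde M$, and let $\widetilde T$ be the full subcomplex of $\widetilde M$ spanned by the vertices at distance at most $R$ from $\tilde g$. Let $T$ be the image of $\widetilde T$ in $M$, and let $\partial T$ be its boundary; an edge of $T$ lies in $\partial T$ if and only if it lies on the boundary of a 2-cell not in $T$. 1. There is a deck transformation (also denoted $g$) which translates $\tilde g$ by $L$ edges, and $h\widetilde T\cap\widetilde T=\emptyset$ for every $h\in G\setminus\langle g\rangle$. 2. Suppose that $\widetilde M$ is $\delta$-hyperbolic. There are constants $C>0$ and $R_0$ depending only on $\widetilde M$ and $\delta$ (hence common to all finite $M$ with torsion-free fundamental group and universal cover $\widetilde M$) such that the following hold. (a) If $A$ is an integral 2-chain in $T$ with $\partial A=mg+c$, where $m\in\mathbb Z$ and the integral 1-chain $c$ is supported in $\partial T$, and if $R\ge R_0$ or $c$ vanishes on all edges of $g$, then $|m|\,2^{(R-R_0-1)/\delta}\le C\|A\|$. (b) If $A\in C_2(M;\mathbb Z)$ and $\partial A=mg$ with $m\in\mathbb Z$, then $|m|\,2^{(R-R_0-1)/\delta}\le C\|A\|$. 3. Suppose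 that $\widetilde M$ is $\delta$-hyperbolic for some $\delta>0$. Let $G=\pi_1(M)\ge G_0\ge G_1\ge G_2\ge\cdots$ be a decreasing sequence of finite-index normal subgroups of $G$ with $\bigcap_iG_i=1$, and put $M_i=\widetilde M/G_i$. Assume that for every $i$ there is a homotopically essential cellular loop in $M_i$, of minimal length among all homotopically essential cellular loops of $M_i$, that is rationally nullhomologous. Then $\rho(M_i;\mathbb Z)\to0$ as $i\to\infty$. -/

import Mathlib

open Filter Topology
open scoped ENNReal

universe u

/-- For a graph given by the initial vertices `src` and the reversal `rev` of its oriented edges: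
the list of oriented edges is an edge path from the first to the second vertex. -/
def EdgePath {V E : Type u} (src : E → V) (rev : E → E) : List E → V → V → Prop
  | [], a, b => a = b
  | e :: l, a, b => src e = a ∧ EdgePath src rev l (src (rev e)) b

/-- A combinatorial two-dimensional cell complex: a graph in the sense of Serre (every geometric
edge is a pair `{e, rev e}` of distinct oriented edges), together with 2-cells, each attached
along a closed edge path `bdry f` which starts and ends at the vertex `base f`.  Loops, multiple
edges, non-reduced and constant attaching paths are allowed. -/
structure TwoComplex : Type (u + 1) where
  V : Type u
  E : Type u
  F : Type u
  src : E → V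
  rev : E → E
  rev_rev : ∀ e, rev (rev e) = e
  rev_ne : ∀ e, rev e ≠ e
  base : F → V
  bdry : F → List E
  isPath_bdry : ∀ f, EdgePath src rev (bdry f) (base f) (base f)

namespace TwoComplex

/-- The terminal vertex of an oriented edge. -/
def tgt (K : TwoComplex.{u}) (e : K.E) : K.V := K.src (K.rev e)

/-- `K.IsPath l a b`: the list `l` of oriented edges is an edge path (a cellular path) from
`a` to `b`. -/
def IsPath (K : TwoComplex.{u}) (l : List K.E) (a b : K.V) : Prop := EdgePath K.src K.rev l a b

/-- `K` has finitely many cells. -/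
def IsFinite (K : TwoComplex.{u}) : Prop := Finite K.V ∧ Finite K.E ∧ Finite K.F

/-! ### Homotopy of edge paths -/

/-- Elementary homotopies: inserting a spur `e, rev e`, or the boundary path of a 2-cell. -/
inductive HomotopyStep (K : TwoComplex.{u}) : List K.E → List K.E → Prop
  | spur (l₁ l₂ : List K.E) (e : K.E) : HomotopyStep K (l₁ ++ l₂) (l₁ ++ [e, K.rev e] ++ l₂)
  | face (l₁ l₂ : List K.E) (f : K.F) : HomotopyStep K (l₁ ++ l₂) (l₁ ++ K.bdry f ++ l₂)

/-- Homotopy relative to the end points, for edge paths from `a` to `b`. All intermediate lists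
are edge paths from `a` to `b`. -/
def Homotopic (K : TwoComplex.{u}) (a b : K.V) :
    {l : List K.E // K.IsPath l a b} → {l : List K.E // K.IsPath l a b} → Prop :=
  Relation.EqvGen fun p q => K.HomotopyStep p.1 q.1

/-- The closed edge path `l` at `a` is null-homotopic. -/
def NullHomotopic (K : TwoComplex.{u}) (a : K.V) (l : List K.E) : Prop :=
  ∃ h : K.IsPath l a a, K.Homotopic a a ⟨l, h⟩ ⟨[], rfl⟩

/-- The fundamental group of `K` at every base point is torsion free: a closed edge path with a
null-homotopic positive power is null-homotopic. -/
def TorsionFreePi1 (K : TwoComplex.{u}) : Prop :=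
  ∀ (a : K.V) (l : List K.E) (n : ℕ), K.IsPath l a a → 0 < n →
    K.NullHomotopic a (List.replicate n l).flatten → K.NullHomotopic a l

/-- Nonempty, connected, with trivial fundamental group. -/
def SimplyConnected (K : TwoComplex.{u}) : Prop :=
  Nonempty K.V ∧ (∀ a b : K.V, ∃ l, K.IsPath l a b) ∧
    ∀ (a : K.V) (l : List K.E), K.IsPath l a a → K.NullHomotopic a l

/-- `g` is a closed edge path at `a` that is homotopically essential, and no homotopically
essential closed edge path of `K` is shorter. -/
structure IsShortestEssential (K : TwoComplex.{u}) (a : K.V) (g : List K.E) : Prop where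
  isPath : K.IsPath g a a
  essential : ¬ K.NullHomotopic a g
  shortest : ∀ (b : K.V) (l : List K.E), K.IsPath l b b → ¬ K.NullHomotopic b l →
    g.length ≤ l.length

/-! ### Cellular chains, the boundary operators, and the filling constant -/

section Chains

variable (K : TwoComplex.{u}) (R : Type) [CommRing R]

/-- Cellular 1-chains: finitely supported functions on oriented edges that change sign under
reversal of the orientation. -/
def OneChain : Submodule R (K.E →₀ R) where
  carrier := {c | ∀ e, c (K.rev e) = - c e}
  zero_mem' := fun e => by simp
  add_mem' := fun {c d} hc hd e => by
    have h1 := hc e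
    have h2 := hd e
    simp only [Finsupp.add_apply, h1, h2]
    ring
  smul_mem' := fun r c hc e => by
    have h1 := hc e
    simp only [Finsupp.smul_apply, h1, smul_neg]

theorem rev_eq_iff (e e' : K.E) : K.rev e = e' ↔ e = K.rev e' :=
  ⟨fun h => by rw [← h, K.rev_rev], fun h => by rw [h, K.rev_rev]⟩

/-- The 1-chain of a single oriented edge. -/
noncomputable def edgeChain (e : K.E) : K.OneChain R :=
  ⟨Finsupp.single e 1 - Finsupp.single (K.rev e) 1, fun e' => by
    classical
    have h : (K.rev e = K.rev e') ↔ (e = e') :=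
      ⟨fun h => by rw [← K.rev_rev e, h, K.rev_rev], fun h => by rw [h]⟩
    simp only [Finsupp.sub_apply, Finsupp.single_apply, h, K.rev_eq_iff e e']
    ring⟩

/-- The 1-chain of an edge path. -/
noncomputable def pathChain (l : List K.E) : K.OneChain R := (l.map (K.edgeChain R)).sum

/-- Cellular 2-chains. -/
abbrev TwoChain : Type u := K.F →₀ R

/-- The boundary operator from 2-chains to 1-chains. -/
noncomputable def bd₂ : K.TwoChain R →ₗ[R] K.OneChain R :=
  Finsupp.linearCombination R fun f => K.pathChain R (K.bdry f)

/-- The boundary operator from 1-chains to 0-chains; it sends the chain of an oriented edge `e` to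
`tgt e - src e`. -/
noncomputable def bd₁ : K.OneChain R →ₗ[R] (K.V →₀ R) :=
  - (Finsupp.lmapDomain R R K.src ∘ₗ (K.OneChain R).subtype)

end Chains

/-- `H₁(K; ℚ)` is nontrivial: some rational 1-cycle is not a boundary. -/
def NontrivialRationalH₁ (K : TwoComplex.{u}) : Prop :=
  ∃ z : K.OneChain ℚ, K.bd₁ ℚ z = 0 ∧ z ∉ LinearMap.range (K.bd₂ ℚ)

/-- A closed edge path is rationally null-homologous if it bounds a rational 2-chain. -/
def RationallyNull (K : TwoComplex.{u}) (g : List K.E) : Prop :=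
  ∃ B : K.TwoChain ℚ, K.bd₂ ℚ B = K.pathChain ℚ g

/-- The `ℓ¹`-norm of an integral 2-chain. -/
noncomputable def norm₂ (K : TwoComplex.{u}) (A : K.TwoChain ℤ) : ℕ := A.sum fun _ n => n.natAbs

/-- The `ℓ¹`-norm of an integral 1-chain, with respect to geometric edges: every geometric edge
appears with both of its orientations in the sum, whence the factor `1 / 2`. -/
noncomputable def norm₁ (K : TwoComplex.{u}) (z : K.OneChain ℤ) : ℝ≥0∞ :=
  (((z : K.E →₀ ℤ).sum fun _ n => n.natAbs : ℕ) : ℝ≥0∞) / 2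

/-- The filling norm of an integral 1-chain. -/
noncomputable def fill (K : TwoComplex.{u}) (z : K.OneChain ℤ) : ℝ≥0∞ :=
  ⨅ (A : K.TwoChain ℤ) (_ : K.bd₂ ℤ A = z), (K.norm₂ A : ℝ≥0∞)

open Classical in
/-- The filling constant `ρ(K; ℤ)`, with the convention that it is `0` if `H₁(K; ℚ)` is
nontrivial. -/
noncomputable def rho (K : TwoComplex.{u}) : ℝ≥0∞ :=
  if K.NontrivialRationalH₁ then 0
  else ⨅ (z : K.OneChain ℤ) (_ : z ∈ LinearMap.range (K.bd₂ ℤ)) (_ : z ≠ 0), K.norm₁ z / K.fill z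

/-! ### The path metric on the 1-skeleton and hyperbolicity -/

/-- Distance of vertices in the 1-skeleton of a connected complex. -/
noncomputable def vdist (K : TwoComplex.{u}) (a b : K.V) : ℕ :=
  sInf {n | ∃ l, K.IsPath l a b ∧ l.length = n}

/-- Points of the 1-skeleton: `(e, t)` is the point of the oriented edge `e` at distance `t` from
`src e`. One point of the 1-skeleton has several such names; these have `pdist` zero. -/
abbrev Point (K : TwoComplex.{u}) : Type u := K.E × Set.Icc (0 : ℝ) 1

/-- Length of a shortest path between two points of the 1-skeleton among the paths which pass
through an end point of the edge of the first and an end point of the edge of the second. -/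
noncomputable def pdistThrough (K : TwoComplex.{u}) (p q : K.Point) : ℝ :=
  min
    (min ((p.2 : ℝ) + K.vdist (K.src p.1) (K.src q.1) + q.2)
      ((p.2 : ℝ) + K.vdist (K.src p.1) (K.tgt q.1) + (1 - q.2)))
    (min ((1 - (p.2 : ℝ)) + K.vdist (K.tgt p.1) (K.src q.1) + q.2)
      ((1 - (p.2 : ℝ)) + K.vdist (K.tgt p.1) (K.tgt q.1) + (1 - q.2)))

open Classical in
/-- The path metric on the 1-skeleton of a connected complex, every edge having length one. -/
noncomputable def pdist (K : TwoComplex.{u}) (p q : K.Point) : ℝ :=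
  if q.1 = p.1 then min |(p.2 : ℝ) - q.2| (K.pdistThrough p q)
  else if q.1 = K.rev p.1 then min |(p.2 : ℝ) - (1 - q.2)| (K.pdistThrough p q)
  else K.pdistThrough p q

/-- `c` restricted to `[0, a]` is a geodesic segment of the 1-skeleton. -/
def IsGeodesic (K : TwoComplex.{u}) (c : ℝ → K.Point) (a : ℝ) : Prop :=
  0 ≤ a ∧ ∀ s ∈ Set.Icc 0 a, ∀ t ∈ Set.Icc 0 a, K.pdist (c s) (c t) = |s - t|

/-- The 1-skeleton is `δ`-hyperbolic: in every geodesic triangle each side is contained in the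
`δ`-neighbourhood of the union of the other two. (The condition for the first side, for all
triangles, gives it for all sides.) -/
def IsHyperbolic (K : TwoComplex.{u}) (δ : ℝ) : Prop :=
  ∀ (c₁ c₂ c₃ : ℝ → K.Point) (a₁ a₂ a₃ : ℝ),
    K.IsGeodesic c₁ a₁ → K.IsGeodesic c₂ a₂ → K.IsGeodesic c₃ a₃ →
    K.pdist (c₁ a₁) (c₂ 0) = 0 → K.pdist (c₂ a₂) (c₃ 0) = 0 → K.pdist (c₃ a₃) (c₁ 0) = 0 →
    ∀ t ∈ Set.Icc 0 a₁, (∃ s ∈ Set.Icc 0 a₂, K.pdist (c₁ t) (c₂ s) ≤ δ) ∨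
      (∃ s ∈ Set.Icc 0 a₃, K.pdist (c₁ t) (c₃ s) ≤ δ)

/-- The vertices at distance at most `r` from a set of vertices. -/
def nbhd (K : TwoComplex.{u}) (S : Set K.V) (r : ℕ) : Set K.V :=
  {x | ∃ y ∈ S, K.vdist x y ≤ r}

/-- The edges of the full subcomplex spanned by a set of vertices. -/
def fullEdges (K : TwoComplex.{u}) (W : Set K.V) : Set K.E := {e | K.src e ∈ W ∧ K.tgt e ∈ W}

/-- The 2-cells of the full subcomplex spanned by a set of vertices. -/
def fullFaces (K : TwoComplex.{u}) (W : Set K.V) : Set K.F :=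
  {f | K.base f ∈ W ∧ ∀ e ∈ K.bdry f, K.src e ∈ W}

/-! ### Coverings, deck transformations and quotients -/

/-- Cellular maps which send cells to cells of the same dimension. -/
structure Hom (K L : TwoComplex.{u}) where
  onV : K.V → L.V
  onE : K.E → L.E
  onF : K.F → L.F
  src_onE : ∀ e, L.src (onE e) = onV (K.src e)
  rev_onE : ∀ e, L.rev (onE e) = onE (K.rev e)
  base_onF : ∀ f, L.base (onF f) = onV (K.base f)
  bdry_onF : ∀ f, L.bdry (onF f) = (K.bdry f).map onE

/-- Covering maps: surjective, and every edge, and every 2-cell with its attaching path, lifts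
uniquely once the lift of its initial vertex, resp. base vertex, is prescribed. -/
structure Hom.IsCovering {K L : TwoComplex.{u}} (p : Hom K L) : Prop where
  surj : Function.Surjective p.onV
  liftE : ∀ (x : K.V) (e : L.E), L.src e = p.onV x → ∃! e' : K.E, K.src e' = x ∧ p.onE e' = e
  liftF : ∀ (x : K.V) (f : L.F), L.base f = p.onV x → ∃! f' : K.F, K.base f' = x ∧ p.onF f' = f

/-- A universal covering: a covering by a (connected and) simply connected complex. -/
def Hom.IsUniversalCover {K L : TwoComplex.{u}} (p : Hom K L) : Prop :=
  p.IsCovering ∧ K.SimplyConnected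

theorem perm_apply_inv {α : Type u} (σ : Equiv.Perm α) (x : α) : σ (σ⁻¹ x) = x :=
  σ.apply_symm_apply x

theorem perm_inv_apply {α : Type u} (σ : Equiv.Perm α) (x : α) : σ⁻¹ (σ x) = x :=
  σ.symm_apply_apply x

/-- The group of deck transformations of `p : K → L`: the cellular automorphisms of `K` over `L`.
For a universal covering it is the fundamental group of `L`, acting on `K`. -/
def deck {K L : TwoComplex.{u}} (p : Hom K L) :
    Subgroup (Equiv.Perm K.V × Equiv.Perm K.E × Equiv.Perm K.F) where
  carrier := {σ | (∀ e, K.src (σ.2.1 e) = σ.1 (K.src e)) ∧ (∀ e, K.rev (σ.2.1 e) = σ.2.1 (K.rev e)) ∧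
    (∀ f, K.base (σ.2.2 f) = σ.1 (K.base f)) ∧ (∀ f, K.bdry (σ.2.2 f) = (K.bdry f).map σ.2.1) ∧
    (∀ x, p.onV (σ.1 x) = p.onV x) ∧ (∀ e, p.onE (σ.2.1 e) = p.onE e) ∧
    (∀ f, p.onF (σ.2.2 f) = p.onF f)}
  one_mem' := by simp
  mul_mem' := by
    rintro σ τ ⟨h1, h2, h3, h4, h5, h6, h7⟩ ⟨k1, k2, k3, k4, k5, k6, k7⟩
    simp only [Set.mem_ofPred_eq, Prod.fst_mul, Prod.snd_mul, Equiv.Perm.mul_apply, Equiv.Perm.coe_mul]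
    refine ⟨fun e => by rw [h1, k1], fun e => by rw [h2, k2], fun f => by rw [h3, k3],
      fun f => by rw [h4, k4, List.map_map], fun x => by rw [h5, k5], fun e => by rw [h6, k6],
      fun f => by rw [h7, k7]⟩
  inv_mem' := by
    rintro σ ⟨h1, h2, h3, h4, h5, h6, h7⟩
    simp only [Set.mem_ofPred_eq, Prod.fst_inv, Prod.snd_inv]
    refine ⟨fun e => ?_, fun e => ?_, fun f => ?_, fun f => ?_, fun x => ?_, fun e => ?_, fun f => ?_⟩
    · rw [Equiv.Perm.eq_inv_iff_eq, ← h1, perm_apply_inv]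
    · rw [Equiv.Perm.eq_inv_iff_eq, ← h2, perm_apply_inv]
    · rw [Equiv.Perm.eq_inv_iff_eq, ← h3, perm_apply_inv]
    · have h := h4 (σ.2.2⁻¹ f)
      rw [perm_apply_inv] at h
      rw [h, List.map_map]
      have : (⇑(σ.2.1⁻¹) ∘ ⇑σ.2.1) = id := by
        funext e
        simp
      rw [this, List.map_id]
    · rw [← h5, perm_apply_inv]
    · rw [← h6, perm_apply_inv]
    · rw [← h7, perm_apply_inv]

section Quotient

variable {K L : TwoComplex.{u}} {p : Hom K L} (H : Subgroup (deck p))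

/-- Two vertices are equivalent if they lie in one `H`-orbit. -/
def orbV : Setoid K.V where
  r x y := ∃ h ∈ H, h.1.1 x = y
  iseqv := by
    refine ⟨fun x => ⟨1, H.one_mem, rfl⟩, ?_, ?_⟩
    · rintro x y ⟨h, hh, rfl⟩
      exact ⟨h⁻¹, H.inv_mem hh, perm_inv_apply _ _⟩
    · rintro x y z ⟨h, hh, rfl⟩ ⟨k, hk, rfl⟩
      exact ⟨k * h, H.mul_mem hk hh, rfl⟩

/-- Two oriented edges are equivalent if they lie in one `H`-orbit. -/
def orbE : Setoid K.E where
  r x y := ∃ h ∈ H, h.1.2.1 x = y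
  iseqv := by
    refine ⟨fun x => ⟨1, H.one_mem, rfl⟩, ?_, ?_⟩
    · rintro x y ⟨h, hh, rfl⟩
      exact ⟨h⁻¹, H.inv_mem hh, perm_inv_apply _ _⟩
    · rintro x y z ⟨h, hh, rfl⟩ ⟨k, hk, rfl⟩
      exact ⟨k * h, H.mul_mem hk hh, rfl⟩

/-- Two 2-cells are equivalent if they lie in one `H`-orbit. -/
def orbF : Setoid K.F where
  r x y := ∃ h ∈ H, h.1.2.2 x = y
  iseqv := by
    refine ⟨fun x => ⟨1, H.one_mem, rfl⟩, ?_, ?_⟩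
    · rintro x y ⟨h, hh, rfl⟩
      exact ⟨h⁻¹, H.inv_mem hh, perm_inv_apply _ _⟩
    · rintro x y z ⟨h, hh, rfl⟩ ⟨k, hk, rfl⟩
      exact ⟨k * h, H.mul_mem hk hh, rfl⟩

/-- The quotient complex `K / H` of a covering complex `K` by a group `H` of deck
transformations. -/
def quot : TwoComplex.{u} where
  V := Quotient (orbV H)
  E := Quotient (orbE H)
  F := Quotient (orbF H)
  src := Quotient.map' K.src (by
    rintro e e' ⟨h, hh, rfl⟩
    exact ⟨h, hh, (h.2.1 e).symm⟩)
  rev := Quotient.map' K.rev (by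
    rintro e e' ⟨h, hh, rfl⟩
    exact ⟨h, hh, (h.2.2.1 e).symm⟩)
  rev_rev := by
    rintro ⟨e⟩
    exact congrArg (Quotient.mk (orbE H)) (K.rev_rev e)
  rev_ne := by
    rintro ⟨e⟩ he
    obtain ⟨h, -, h2⟩ := Quotient.exact he
    have h3 := h.2.2.2.2.2.2.1 (K.rev e)
    rw [h2, ← p.rev_onE] at h3
    exact L.rev_ne _ h3.symm
  base := Quotient.map' K.base (by
    rintro f f' ⟨h, hh, rfl⟩
    exact ⟨h, hh, (h.2.2.2.1 f).symm⟩)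
  bdry := Quotient.lift (fun f => (K.bdry f).map (Quotient.mk (orbE H))) (by
    rintro f f' ⟨h, hh, rfl⟩
    simp only [h.2.2.2.2.1 f, List.map_map]
    refine List.map_congr_left fun e _ => Quotient.sound ⟨h, hh, rfl⟩)
  isPath_bdry := by
    rintro ⟨f⟩
    have key : ∀ (src' : Quotient (orbE H) → Quotient (orbV H))
        (rev' : Quotient (orbE H) → Quotient (orbE H)),
        (∀ e, src' (Quotient.mk _ e) = Quotient.mk _ (K.src e)) →
        (∀ e, rev' (Quotient.mk _ e) = Quotient.mk _ (K.rev e)) →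
        ∀ (l : List K.E) (a b : K.V), EdgePath K.src K.rev l a b →
          EdgePath src' rev' (l.map (Quotient.mk _)) (Quotient.mk _ a) (Quotient.mk _ b) := by
      intro src' rev' hs hr l
      induction l with
      | nil => exact fun a b h => congrArg _ h
      | cons e l ih =>
        refine fun a b h => ⟨(hs e).trans (congrArg _ h.1), ?_⟩
        rw [hr, hs]
        exact ih _ _ h.2
    exact key _ _ (fun _ => rfl) (fun _ => rfl) _ _ _ (K.isPath_bdry f)

end Quotient

/-- A residual chain of a group: a decreasing sequence of normal subgroups of finite index with
trivial intersection. -/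
structure IsResidualChain {G : Type u} [Group G] (N : ℕ → Subgroup G) : Prop where
  anti : Antitone N
  normal : ∀ i, (N i).Normal
  finiteIndex : ∀ i, (N i).FiniteIndex
  trivial : ⨅ i, N i = ⊥

/-! ### Tubes around lifts of loops -/

/-- The bi-infinite edge path `γ` is a lift of the closed edge path `g` (run through
periodically). -/
structure IsLift {K L : TwoComplex.{u}} (p : Hom K L) (g : List L.E) (γ : ℤ → K.E) : Prop where
  joined : ∀ n, K.tgt (γ n) = K.src (γ (n + 1))
  covers : ∀ n : ℤ, g[(n % (g.length : ℤ)).toNat]? = some (p.onE (γ n))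

/-- The vertices of the cellular neighbourhood of radius `⌊(L - 1) / 4⌋` of a lift `γ` of `g`,
where `L ≥ 1` is the length of `g`. The neighbourhood itself is the full subcomplex spanned by
these vertices. -/
def tubeV {K L : TwoComplex.{u}} (g : List L.E) (γ : ℤ → K.E) : Set K.V :=
  K.nbhd (Set.range fun n => K.src (γ n)) ((g.length - 1) / 4)

/-- The edges of the image in `L` of the cellular neighbourhood of `γ`. -/
def tubeImageE {K L : TwoComplex.{u}} (p : Hom K L) (g : List L.E) (γ : ℤ → K.E) : Set L.E :=
  p.onE '' K.fullEdges (tubeV g γ)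

/-- The 2-cells of the image in `L` of the cellular neighbourhood of `γ`. -/
def tubeImageF {K L : TwoComplex.{u}} (p : Hom K L) (g : List L.E) (γ : ℤ → K.E) : Set L.F :=
  p.onF '' K.fullFaces (tubeV g γ)

/-- The edges in the (topological) boundary of the image of the cellular neighbourhood of `γ`: the
edges of the image that lie on the boundary of a 2-cell outside of it. -/
def tubeFrontier {K L : TwoComplex.{u}} (p : Hom K L) (g : List L.E) (γ : ℤ → K.E) : Set L.E :=
  {e | e ∈ tubeImageE p g γ ∧
    ∃ f, f ∉ tubeImageF p g γ ∧ (e ∈ L.bdry f ∨ L.rev e ∈ L.bdry f)}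

end TwoComplex

/-! Let L be the length of g. A path from x to hx in the universal cover, for a deck transformation
h ≠ 1, projects to an essential loop, so h moves every vertex by at least L
(`IsShortestEssential.le_displacement`). Hence the lift γ, the axis, is an L-local geodesic,
translated by some τ. If x and hx both lie within R of it, then for a suitable b the element h⁻¹τ^b
moves a vertex of the axis by at most 2R + L/2 < L, so h = τ^b (`IsLift.mem_zpowers`). This is 1.

Part 2 is a duality argument. A real 1-cochain on M which is L on g, vanishes on the frontier of T,
and is at most κ in absolute value on the boundary of every 2-cell gives |m| L ≤ κ‖A‖. The cochain
is the difference of a function on a tube of radius r, somewhat less than R, extended by zero; the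
function grows by L under τ, so that its differences descend to M. The index of a nearest vertex of
the axis has this equivariance, but it can jump along edges. Hyperbolicity controls the jumps: a
chain of at most 2^k edges at distance at least d > (k + 2)δ + 1 from the axis moves the projection
by at most a constant B (`HyperbolicTube.natAbs_sub_le_of_short_chain`). So one minimises (index at
the end of the chain) + ε (number of steps), with ε = B / 2^k, over chains in the outer part of the
tube. The resulting `potential` is finite, equivariant, and changes by at most ε along outer edges.
A 2-cell with a lift in the tube has value 0; any other one meets the tube in outer edges only and
has value at most Nε, where N bounds the lengths of attaching paths
(`HyperbolicTube.abs_sum_bdry_le`). Taking k about R/δ gives the exponential bound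
(`exists_filling_constants`). For small R it suffices to read off the coefficient of an edge that g
passes only once. Torsion-freeness makes τ of infinite order, so that vertices of the axis near to
each other in the cover are also near along the axis.

For 3, all M_i have the same universal cover, hence the same constants. Residual finiteness forces
the minimal lengths L_i to infinity (`Hom.IsUniversalCover.eventually_lt_length`). Some nonzero
multiple of the rationally null shortest loop bounds integrally, and testing ρ on it gives at most
L_i divided by an exponential in L_i (`rho_le_of_filling`). -/

namespace TwoComplex

/-! ### Edge paths and the vertex metric -/

section Paths

variable {K L : TwoComplex.{u}}

theorem tgt_rev (e : K.E) : K.tgt (K.rev e) = K.src e := by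
  rw [tgt, K.rev_rev]

theorem isPath_nil {a b : K.V} : K.IsPath [] a b ↔ a = b := Iff.rfl

theorem isPath_cons {e : K.E} {l : List K.E} {a b : K.V} :
    K.IsPath (e :: l) a b ↔ K.src e = a ∧ K.IsPath l (K.tgt e) b := Iff.rfl

theorem isPath_append {l₁ l₂ : List K.E} {a b : K.V} :
    K.IsPath (l₁ ++ l₂) a b ↔ ∃ c, K.IsPath l₁ a c ∧ K.IsPath l₂ c b := by
  induction l₁ generalizing a with
  | nil => simp [isPath_nil]
  | cons e l ih => simp [isPath_cons, ih, and_assoc]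

theorem isPath_singleton (e : K.E) : K.IsPath [e] (K.src e) (K.tgt e) := ⟨rfl, rfl⟩

theorem IsPath.end_unique {l : List K.E} {a b c : K.V} (h : K.IsPath l a b) (h' : K.IsPath l a c) :
    b = c := by
  induction l generalizing a with
  | nil => exact (isPath_nil.1 h).symm.trans (isPath_nil.1 h')
  | cons e l ih => exact ih h.2 h'.2

theorem IsPath.reverse {l : List K.E} {a b : K.V} (h : K.IsPath l a b) :
    K.IsPath (l.reverse.map K.rev) b a := by
  induction l generalizing a with
  | nil => exact (isPath_nil.1 h).symm
  | cons e l ih =>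
    rw [List.reverse_cons, List.map_append, isPath_append]
    refine ⟨_, ih h.2, rfl, ?_⟩
    exact (tgt_rev _).trans h.1

theorem Hom.tgt_onE (p : Hom K L) (e : K.E) : L.tgt (p.onE e) = p.onV (K.tgt e) := by
  rw [tgt, p.rev_onE, p.src_onE, tgt]

theorem Hom.map_isPath (p : Hom K L) {l : List K.E} {a b : K.V} (h : K.IsPath l a b) :
    L.IsPath (l.map p.onE) (p.onV a) (p.onV b) := by
  induction l generalizing a with
  | nil => exact congrArg _ (isPath_nil.1 h)
  | cons e l ih =>
    refine isPath_cons.2 ⟨(p.src_onE e).trans (congrArg _ h.1), ?_⟩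
    rw [p.tgt_onE]
    exact ih h.2

/-- Any two vertices are joined by an edge path. -/
def Connected (K : TwoComplex.{u}) : Prop := ∀ a b : K.V, ∃ l, K.IsPath l a b

theorem vdist_le_length {l : List K.E} {a b : K.V} (h : K.IsPath l a b) : K.vdist a b ≤ l.length :=
  Nat.sInf_le ⟨l, h, rfl⟩

theorem Connected.exists_path (hK : K.Connected) (a b : K.V) :
    ∃ l, K.IsPath l a b ∧ l.length = K.vdist a b := by
  obtain ⟨l, hl⟩ := hK a b
  exact Nat.sInf_mem (s := {n | ∃ l, K.IsPath l a b ∧ l.length = n}) ⟨_, l, hl, rfl⟩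

theorem vdist_self (a : K.V) : K.vdist a a = 0 :=
  Nat.le_zero.1 (vdist_le_length (l := []) rfl)

theorem vdist_comm (a b : K.V) : K.vdist a b = K.vdist b a := by
  unfold vdist
  congr 1
  ext n
  constructor <;>
  · rintro ⟨l, hl, rfl⟩
    exact ⟨_, hl.reverse, by simp⟩

theorem Connected.vdist_triangle (hK : K.Connected) (a b c : K.V) :
    K.vdist a c ≤ K.vdist a b + K.vdist b c := by
  obtain ⟨l, hl, hl'⟩ := hK.exists_path a b
  obtain ⟨m, hm, hm'⟩ := hK.exists_path b c
  rw [← hl', ← hm', ← List.length_append]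
  exact vdist_le_length (isPath_append.2 ⟨b, hl, hm⟩)

theorem vdist_src_tgt (e : K.E) : K.vdist (K.src e) (K.tgt e) ≤ 1 :=
  vdist_le_length (isPath_singleton e)

theorem Hom.vdist_le (p : Hom K L) (hK : K.Connected) (a b : K.V) :
    L.vdist (p.onV a) (p.onV b) ≤ K.vdist a b := by
  obtain ⟨l, hl, hl'⟩ := hK.exists_path a b
  rw [← hl', ← List.length_map (f := p.onE)]
  exact vdist_le_length (p.map_isPath hl)

theorem IsPath.vdist_src_le {l : List K.E} {a b : K.V} (h : K.IsPath l a b) {e : K.E}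
    (he : e ∈ l) : K.vdist a (K.src e) ≤ l.length := by
  obtain ⟨l₁, l₂, rfl⟩ := List.append_of_mem he
  obtain ⟨c, h1, h2⟩ := isPath_append.1 h
  rw [h2.1]
  exact (vdist_le_length h1).trans (by simp)

end Paths

/-! ### Lifting of paths and homotopies -/

section Lifting

variable {K L : TwoComplex.{u}} {p : Hom K L}

/-- The edge path `l` has a lift from `x` to `y`. -/
def Hom.EndsAt (p : Hom K L) (x : K.V) (l : List L.E) (y : K.V) : Prop :=
  ∃ l', K.IsPath l' x y ∧ l'.map p.onE = l

theorem Hom.EndsAt.isPath {x y : K.V} {l : List L.E} (h : p.EndsAt x l y) :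
    L.IsPath l (p.onV x) (p.onV y) := by
  obtain ⟨l', h, rfl⟩ := h
  exact p.map_isPath h

theorem Hom.endsAt_nil {x y : K.V} : p.EndsAt x [] y ↔ x = y := by
  constructor
  · rintro ⟨l, h, h'⟩
    rw [List.map_eq_nil_iff] at h'
    subst h'
    exact h
  · rintro rfl
    exact ⟨[], rfl, rfl⟩

theorem Hom.endsAt_append {x y : K.V} {l₁ l₂ : List L.E} :
    p.EndsAt x (l₁ ++ l₂) y ↔ ∃ z, p.EndsAt x l₁ z ∧ p.EndsAt z l₂ y := by
  constructor
  · rintro ⟨l, h, h'⟩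
    obtain ⟨m₁, m₂, rfl, rfl, rfl⟩ := List.map_eq_append_iff.1 h'
    obtain ⟨z, h1, h2⟩ := isPath_append.1 h
    exact ⟨z, ⟨_, h1, rfl⟩, ⟨_, h2, rfl⟩⟩
  · rintro ⟨z, ⟨m₁, h1, rfl⟩, ⟨m₂, h2, rfl⟩⟩
    exact ⟨m₁ ++ m₂, isPath_append.2 ⟨z, h1, h2⟩, by simp⟩

theorem Hom.IsCovering.edge_unique (hp : p.IsCovering) {e e' : K.E} (h : K.src e = K.src e')
    (h' : p.onE e = p.onE e') : e = e' :=
  (hp.liftE (K.src e') (p.onE e') (p.src_onE e')).unique ⟨h, h'⟩ ⟨rfl, rfl⟩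

theorem Hom.IsCovering.face_unique (hp : p.IsCovering) {f f' : K.F} (h : K.base f = K.base f')
    (h' : p.onF f = p.onF f') : f = f' :=
  (hp.liftF (K.base f') (p.onF f') (p.base_onF f')).unique ⟨h, h'⟩ ⟨rfl, rfl⟩

theorem Hom.IsCovering.lift_unique (hp : p.IsCovering) {l l' : List K.E} {x y y' : K.V}
    (h : K.IsPath l x y) (h' : K.IsPath l' x y') (hl : l.map p.onE = l'.map p.onE) :
    l = l' := by
  induction l generalizing x l' with
  | nil => exact (List.map_eq_nil_iff.1 hl.symm).symm
  | cons e l ih =>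
    cases l' with
    | nil => simp at hl
    | cons e' l' =>
      rw [List.map_cons, List.map_cons, List.cons.injEq] at hl
      obtain rfl := hp.edge_unique (h.1.trans h'.1.symm) hl.1
      rw [ih h.2 h'.2 hl.2]

theorem Hom.IsCovering.endsAt_unique (hp : p.IsCovering) {l : List L.E} {x y y' : K.V}
    (h : p.EndsAt x l y) (h' : p.EndsAt x l y') : y = y' := by
  obtain ⟨m, h, rfl⟩ := h
  obtain ⟨m', h', hm⟩ := h'
  obtain rfl := hp.lift_unique h' h hm
  exact h.end_unique h'

theorem Hom.IsCovering.exists_endsAt (hp : p.IsCovering) {l : List L.E} {x : K.V} {b : L.V}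
    (h : L.IsPath l (p.onV x) b) : ∃ y, p.EndsAt x l y ∧ p.onV y = b := by
  induction l generalizing x with
  | nil => exact ⟨x, Hom.endsAt_nil.2 rfl, h⟩
  | cons e l ih =>
    obtain ⟨e', ⟨rfl, rfl⟩, -⟩ := hp.liftE x e h.1
    have h2 := h.2
    change L.IsPath l (L.tgt _) b at h2
    rw [p.tgt_onE] at h2
    obtain ⟨y, ⟨l', hl, rfl⟩, hy⟩ := ih h2
    exact ⟨y, ⟨e' :: l', ⟨rfl, hl⟩, rfl⟩, hy⟩

theorem Hom.IsCovering.endsAt_spur (hp : p.IsCovering) {e : L.E} {x y : K.V}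
    (h : L.src e = p.onV x) : p.EndsAt x [e, L.rev e] y ↔ x = y := by
  obtain ⟨e', ⟨rfl, rfl⟩, -⟩ := hp.liftE x e h
  have h1 : p.EndsAt (K.src e') [p.onE e', L.rev (p.onE e')] (K.src e') :=
    ⟨[e', K.rev e'], ⟨rfl, rfl, tgt_rev e'⟩, by simp [p.rev_onE]⟩
  exact ⟨fun h => hp.endsAt_unique h1 h, fun h => h ▸ h1⟩

theorem Hom.IsCovering.endsAt_bdry (hp : p.IsCovering) {f : L.F} {x y : K.V}
    (h : L.base f = p.onV x) : p.EndsAt x (L.bdry f) y ↔ x = y := by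
  obtain ⟨f', ⟨rfl, rfl⟩, -⟩ := hp.liftF x f h
  have h1 : p.EndsAt (K.base f') (L.bdry (p.onF f')) (K.base f') :=
    ⟨K.bdry f', K.isPath_bdry f', (p.bdry_onF f').symm⟩
  exact ⟨fun h => hp.endsAt_unique h1 h, fun h => h ▸ h1⟩

/-- A spur or an attaching path lifts to a closed path, so inserting it does not change where the
lift ends. -/
theorem Hom.IsCovering.endsAt_of_homotopyStep (hp : p.IsCovering) {l l' : List L.E}
    (h : L.HomotopyStep l l') {x : K.V} {b : L.V} (hl' : L.IsPath l' (p.onV x) b) (y : K.V) :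
    p.EndsAt x l y ↔ p.EndsAt x l' y := by
  have key : ∀ (l₁ l₂ m : List L.E),
      (∀ z, L.IsPath l₁ (p.onV x) (p.onV z) → ∀ w, p.EndsAt z m w ↔ z = w) →
      (p.EndsAt x (l₁ ++ l₂) y ↔ p.EndsAt x (l₁ ++ m ++ l₂) y) := by
    intro l₁ l₂ m hm
    simp only [Hom.endsAt_append]
    constructor
    · rintro ⟨z, h1, h2⟩
      exact ⟨z, ⟨z, h1, (hm z h1.isPath z).2 rfl⟩, h2⟩
    · rintro ⟨z, ⟨w, h1, h2⟩, h3⟩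
      obtain rfl := (hm w h1.isPath z).1 h2
      exact ⟨w, h1, h3⟩
  cases h with
  | spur l₁ l₂ e =>
    refine key l₁ l₂ _ fun z hz w => hp.endsAt_spur ?_
    rw [List.append_assoc] at hl'
    obtain ⟨c, h1, h2⟩ := isPath_append.1 hl'
    exact h2.1.trans (h1.end_unique hz)
  | face l₁ l₂ f =>
    refine key l₁ l₂ _ fun z hz w => ?_
    rw [List.append_assoc] at hl'
    obtain ⟨c, h1, h2⟩ := isPath_append.1 hl'
    obtain ⟨d, h3, -⟩ := isPath_append.1 h2
    obtain rfl := h1.end_unique hz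
    -- A constant attaching path may be inserted at any vertex, not only at `L.base f`, so the
    -- lifting property of 2-cells says nothing there; the empty path is treated separately.
    cases hb : L.bdry f with
    | nil => exact Hom.endsAt_nil
    | cons e m =>
      rw [← hb]
      refine hp.endsAt_bdry ?_
      have h4 := L.isPath_bdry f
      rw [hb] at h3 h4
      exact h4.1.symm.trans h3.1

theorem Hom.IsCovering.endsAt_of_homotopic (hp : p.IsCovering) {x : K.V} {b : L.V}
    {l l' : {l : List L.E // L.IsPath l (p.onV x) b}} (h : L.Homotopic (p.onV x) b l l') (y : K.V) :
    p.EndsAt x l.1 y ↔ p.EndsAt x l'.1 y := by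
  induction h with
  | rel l l' h => exact hp.endsAt_of_homotopyStep h l'.2 y
  | refl => rfl
  | symm _ _ _ ih => exact ih.symm
  | trans _ _ _ _ _ ih1 ih2 => exact ih1.trans ih2

theorem Hom.map_homotopyStep (p : Hom K L) {l l' : List K.E} (h : K.HomotopyStep l l') :
    L.HomotopyStep (l.map p.onE) (l'.map p.onE) := by
  cases h with
  | spur l₁ l₂ e =>
    simpa [p.rev_onE] using HomotopyStep.spur (K := L) (l₁.map p.onE) (l₂.map p.onE) (p.onE e)
  | face l₁ l₂ f =>
    simpa [p.bdry_onF] using HomotopyStep.face (K := L) (l₁.map p.onE) (l₂.map p.onE) (p.onF f)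

theorem Hom.map_homotopic (p : Hom K L) {a b : K.V} {l l' : {l : List K.E // K.IsPath l a b}}
    (h : K.Homotopic a b l l') :
    L.Homotopic (p.onV a) (p.onV b) ⟨l.1.map p.onE, p.map_isPath l.2⟩
      ⟨l'.1.map p.onE, p.map_isPath l'.2⟩ := by
  induction h with
  | rel l l' h => exact .rel _ _ (p.map_homotopyStep h)
  | refl => exact .refl _
  | symm _ _ _ ih => exact .symm _ _ ih
  | trans _ _ _ _ _ ih1 ih2 => exact .trans _ _ _ ih1 ih2

theorem Hom.map_nullHomotopic (p : Hom K L) {a : K.V} {l : List K.E} (h : K.NullHomotopic a l) :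
    L.NullHomotopic (p.onV a) (l.map p.onE) :=
  ⟨p.map_isPath h.1, p.map_homotopic h.2⟩

/-- This turns homotopy below into a statement about end points of lifts, the form in which
essential loops and torsion are used later. -/
theorem Hom.IsUniversalCover.nullHomotopic_iff (hp : p.IsUniversalCover) {x : K.V}
    {l : List L.E} : L.NullHomotopic (p.onV x) l ↔ p.EndsAt x l x := by
  constructor
  · rintro ⟨h, h'⟩
    exact (hp.1.endsAt_of_homotopic h' x).2 (Hom.endsAt_nil.2 rfl)
  · rintro ⟨l, h, rfl⟩
    exact p.map_nullHomotopic (hp.2.2.2 x l h)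

theorem Hom.IsUniversalCover.connected (hp : p.IsUniversalCover) : K.Connected := hp.2.2.1

end Lifting

/-! ### Deck transformations -/

section Deck

variable {K L : TwoComplex.{u}} {p : Hom K L}

/-- A deck transformation as a cellular map. -/
def deckHom (h : deck p) : Hom K K where
  onV := h.1.1
  onE := h.1.2.1
  onF := h.1.2.2
  src_onE := h.2.1
  rev_onE := h.2.2.1
  base_onF := h.2.2.2.1
  bdry_onF := h.2.2.2.2.1

theorem deck_onV (h : deck p) (x : K.V) : p.onV (h.1.1 x) = p.onV x := h.2.2.2.2.2.1 x

theorem deck_onE (h : deck p) (e : K.E) : p.onE (h.1.2.1 e) = p.onE e := h.2.2.2.2.2.2.1 e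

theorem deck_onF (h : deck p) (f : K.F) : p.onF (h.1.2.2 f) = p.onF f := h.2.2.2.2.2.2.2 f

theorem deck_src (h : deck p) (e : K.E) : K.src (h.1.2.1 e) = h.1.1 (K.src e) := h.2.1 e

theorem deck_tgt (h : deck p) (e : K.E) : K.tgt (h.1.2.1 e) = h.1.1 (K.tgt e) :=
  (deckHom h).tgt_onE e

theorem deck_inv_apply (h : deck p) (x : K.V) : (h⁻¹).1.1 (h.1.1 x) = x := perm_inv_apply _ x

theorem deck_apply_inv (h : deck p) (x : K.V) : h.1.1 ((h⁻¹).1.1 x) = x := perm_apply_inv _ x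

theorem deck_mul_apply (h k : deck p) (x : K.V) : (h * k).1.1 x = h.1.1 (k.1.1 x) := rfl

theorem Connected.deck_vdist (hK : K.Connected) (h : deck p) (a b : K.V) :
    K.vdist (h.1.1 a) (h.1.1 b) = K.vdist a b := by
  refine le_antisymm ((deckHom h).vdist_le hK a b) ?_
  have := (deckHom h⁻¹).vdist_le hK (h.1.1 a) (h.1.1 b)
  change K.vdist ((h⁻¹).1.1 _) ((h⁻¹).1.1 _) ≤ _ at this
  rwa [deck_inv_apply, deck_inv_apply] at this

theorem Hom.EndsAt.translate {x y : K.V} {l : List L.E} (hl : p.EndsAt x l y) (h : TwoComplex.deck p) :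
    p.EndsAt (h.1.1 x) l (h.1.1 y) := by
  obtain ⟨m, hm, rfl⟩ := hl
  refine ⟨_, (deckHom h).map_isPath hm, ?_⟩
  rw [List.map_map]
  exact List.map_congr_left fun e _ => deck_onE h e

theorem Hom.EndsAt.reverse {x y : K.V} {l : List L.E} (hl : p.EndsAt x l y) :
    p.EndsAt y (l.reverse.map L.rev) x := by
  obtain ⟨m, hm, rfl⟩ := hl
  refine ⟨_, hm.reverse, ?_⟩
  simp [← List.map_reverse, p.rev_onE]

theorem reverse_reverse_path (l : List K.E) : ((l.reverse.map K.rev).reverse.map K.rev) = l := by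
  rw [← List.map_reverse, List.reverse_reverse, List.map_map]
  have : K.rev ∘ K.rev = id := funext K.rev_rev
  rw [this, List.map_id]

/-- Both transformations carry a path from x to z to lifts of one path with one starting point;
unique lifting gives agreement at z. -/
theorem Hom.IsUniversalCover.deck_eq (hp : p.IsUniversalCover) {h k : deck p} {x : K.V}
    (hx : h.1.1 x = k.1.1 x) : h = k := by
  have hV : ∀ z, h.1.1 z = k.1.1 z := by
    intro z
    obtain ⟨l, hl⟩ := hp.connected x z
    have hz : p.EndsAt x (l.map p.onE) z := ⟨l, hl, rfl⟩
    have h1 := hz.translate h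
    rw [hx] at h1
    exact hp.1.endsAt_unique h1 (hz.translate k)
  refine Subtype.ext (Prod.ext (Equiv.ext hV) (Prod.ext (Equiv.ext fun e => ?_)
    (Equiv.ext fun f => ?_)))
  · refine hp.1.edge_unique ?_ ((deck_onE h e).trans (deck_onE k e).symm)
    rw [deck_src, deck_src, hV]
  · refine hp.1.face_unique ?_ ((deck_onF h f).trans (deck_onF k f).symm)
    rw [h.2.2.2.1, k.2.2.2.1, hV]

/-- `z` and `w` are end points of lifts, starting at `x` and `y`, of the same edge path. -/
def Hom.Transport (p : Hom K L) (x y z w : K.V) : Prop := ∃ l, p.EndsAt x l z ∧ p.EndsAt y l w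

theorem Hom.Transport.symm {x y z w : K.V} (h : p.Transport x y z w) : p.Transport y x w z := by
  obtain ⟨l, h1, h2⟩ := h
  exact ⟨l, h2, h1⟩

theorem Hom.Transport.onV_eq {x y z w : K.V} (h : p.Transport x y z w) (hxy : p.onV x = p.onV y) :
    p.onV z = p.onV w := by
  obtain ⟨l, h1, h2⟩ := h
  have h3 := h2.isPath
  rw [← hxy] at h3
  exact h1.isPath.end_unique h3

theorem Hom.Transport.tgt {x y : K.V} {e e' : K.E} (h : p.Transport x y (K.src e) (K.src e'))
    (he : p.onE e = p.onE e') : p.Transport x y (K.tgt e) (K.tgt e') := by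
  obtain ⟨l, h1, h2⟩ := h
  exact ⟨l ++ [p.onE e], Hom.endsAt_append.2 ⟨_, h1, [e], isPath_singleton e, rfl⟩,
    Hom.endsAt_append.2 ⟨_, h2, [e'], isPath_singleton e', by simp [he]⟩⟩

/-- Two paths from x to z form a loop whose image below is null-homotopic, so this image also lifts
to a closed path at y. -/
theorem Hom.IsUniversalCover.transport_unique (hp : p.IsUniversalCover) {x y z w w' : K.V}
    (hxy : p.onV x = p.onV y) (h : p.Transport x y z w) (h' : p.Transport x y z w') : w = w' := by
  obtain ⟨l, h1, h2⟩ := h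
  obtain ⟨l', h1', h2'⟩ := h'
  have h3 : p.EndsAt x (l ++ l'.reverse.map L.rev) x := Hom.endsAt_append.2 ⟨z, h1, h1'.reverse⟩
  rw [← hp.nullHomotopic_iff, hxy, hp.nullHomotopic_iff] at h3
  obtain ⟨u, h4, h5⟩ := Hom.endsAt_append.1 h3
  have h6 := h5.reverse
  rw [reverse_reverse_path] at h6
  rw [hp.1.endsAt_unique h2 h4, hp.1.endsAt_unique h2' h6]

theorem Hom.IsUniversalCover.exists_transport (hp : p.IsUniversalCover) {x y : K.V}
    (hxy : p.onV x = p.onV y) (z : K.V) : ∃ w, p.Transport x y z w := by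
  obtain ⟨l, hl⟩ := hp.connected x z
  have h := p.map_isPath hl
  rw [hxy] at h
  obtain ⟨w, hw, -⟩ := hp.1.exists_endsAt h
  exact ⟨w, _, ⟨l, hl, rfl⟩, hw⟩

theorem exists_perm_of_existsUnique {α : Type u} {r : α → α → Prop} (h : ∀ a, ∃! b, r a b)
    (h' : ∀ b, ∃! a, r a b) : ∃ σ : Equiv.Perm α, ∀ a b, r a b ↔ σ a = b := by
  choose f hf hf' using h
  refine ⟨Equiv.ofBijective f ⟨fun a b hab => ?_, fun b => ?_⟩, fun a b => ?_⟩
  · have h2 := hf b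
    rw [← hab] at h2
    exact (h' (f a)).unique (hf a) h2
  · obtain ⟨a, ha, -⟩ := h' b
    exact ⟨a, (hf' a b ha).symm⟩
  · exact ⟨fun h => (hf' a b h).symm, fun h => h ▸ hf a⟩

/-- The transformation sends z to the end of the lift, starting at y, of the projection of any path
from x to z. Edges and 2-cells follow their initial and base vertices by unique lifting. -/
theorem Hom.IsUniversalCover.exists_deck (hp : p.IsUniversalCover) {x y : K.V}
    (hxy : p.onV x = p.onV y) : ∃ h : deck p, h.1.1 x = y := by
  have huV : ∀ {x y}, p.onV x = p.onV y → ∀ z, ∃! w, p.Transport x y z w := fun hxy z => by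
    obtain ⟨w, hw⟩ := hp.exists_transport hxy z
    exact ⟨w, hw, fun w' hw' => hp.transport_unique hxy hw' hw⟩
  have huE : ∀ {x y}, p.onV x = p.onV y →
      ∀ e, ∃! e', p.Transport x y (K.src e) (K.src e') ∧ p.onE e = p.onE e' := fun hxy e => by
    obtain ⟨w, hw, hw'⟩ := huV hxy (K.src e)
    obtain ⟨e', ⟨rfl, he'⟩, -⟩ := hp.1.liftE w (p.onE e) ((p.src_onE e).trans (hw.onV_eq hxy))
    exact ⟨e', ⟨hw, he'.symm⟩, fun e'' h => hp.1.edge_unique (hw' _ h.1) (h.2.symm.trans he'.symm)⟩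
  have huF : ∀ {x y}, p.onV x = p.onV y →
      ∀ f, ∃! f', p.Transport x y (K.base f) (K.base f') ∧ p.onF f = p.onF f' := fun hxy f => by
    obtain ⟨w, hw, hw'⟩ := huV hxy (K.base f)
    obtain ⟨f', ⟨rfl, hf'⟩, -⟩ := hp.1.liftF w (p.onF f) ((p.base_onF f).trans (hw.onV_eq hxy))
    exact ⟨f', ⟨hw, hf'.symm⟩, fun f'' h => hp.1.face_unique (hw' _ h.1) (h.2.symm.trans hf'.symm)⟩
  -- Exchanging x and y inverts the relation, so existence and uniqueness of images also give
  -- bijectivity.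
  have sw : ∀ z w, p.Transport y x z w ↔ p.Transport x y w z := fun z w => ⟨.symm, .symm⟩
  obtain ⟨σ, hσ⟩ := exists_perm_of_existsUnique (huV hxy)
    (by simpa only [sw] using huV hxy.symm)
  obtain ⟨ε, hε⟩ := exists_perm_of_existsUnique (huE hxy)
    (by simpa only [sw, eq_comm] using huE hxy.symm)
  obtain ⟨φ, hφ⟩ := exists_perm_of_existsUnique (huF hxy)
    (by simpa only [sw, eq_comm] using huF hxy.symm)
  have h1 : ∀ e, K.src (ε e) = σ (K.src e) := fun e => ((hσ _ _).1 ((hε e _).2 rfl).1).symm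
  have h2 : ∀ e, K.rev (ε e) = ε (K.rev e) := fun e => by
    have h := (hε e _).2 rfl
    refine ((hε _ _).1 ⟨h.1.tgt h.2, ?_⟩).symm
    rw [← p.rev_onE, ← p.rev_onE, h.2]
  have h3 : ∀ f, K.base (φ f) = σ (K.base f) := fun f => ((hσ _ _).1 ((hφ f _).2 rfl).1).symm
  have h5 : ∀ z, p.onV (σ z) = p.onV z := fun z => (((hσ z _).2 rfl).onV_eq hxy).symm
  have h6 : ∀ e, p.onE (ε e) = p.onE e := fun e => ((hε e _).2 rfl).2.symm
  have h7 : ∀ f, p.onF (φ f) = p.onF f := fun f => ((hφ f _).2 rfl).2.symm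
  have h8 : ∀ (l : List K.E) (a b : K.V), K.IsPath l a b → K.IsPath (l.map ε) (σ a) (σ b) := by
    intro l
    induction l with
    | nil => exact fun a b h => congrArg _ h
    | cons e l ih =>
      refine fun a b h => ⟨(h1 e).trans (congrArg _ h.1), ?_⟩
      rw [h2, h1]
      exact ih _ _ h.2
  have h4 : ∀ f, K.bdry (φ f) = (K.bdry f).map ε := fun f => by
    have h9 := K.isPath_bdry (φ f)
    rw [h3] at h9
    refine hp.1.lift_unique h9 (h8 _ _ _ (K.isPath_bdry f)) ?_
    rw [← p.bdry_onF, h7, p.bdry_onF, List.map_map]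
    exact (List.map_congr_left fun e _ => h6 e).symm
  refine ⟨⟨(σ, ε, φ), h1, h2, h3, h4, h5, h6, h7⟩, (hσ x y).1 ⟨[], ?_, ?_⟩⟩
  · exact Hom.endsAt_nil.2 rfl
  · exact Hom.endsAt_nil.2 rfl

theorem Hom.IsUniversalCover.exists_deck_edge (hp : p.IsUniversalCover) {e e' : K.E}
    (h : p.onE e = p.onE e') : ∃ k : deck p, k.1.2.1 e = e' := by
  obtain ⟨k, hk⟩ := hp.exists_deck (x := K.src e) (y := K.src e') (by
    rw [← p.src_onE, ← p.src_onE, h])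
  exact ⟨k, hp.1.edge_unique ((deck_src k e).trans hk) ((deck_onE k e).trans h)⟩

theorem Hom.IsUniversalCover.exists_deck_face (hp : p.IsUniversalCover) {f f' : K.F}
    (h : p.onF f = p.onF f') : ∃ k : deck p, k.1.2.2 f = f' := by
  obtain ⟨k, hk⟩ := hp.exists_deck (x := K.base f) (y := K.base f') (by
    rw [← p.base_onF, ← p.base_onF, h])
  exact ⟨k, hp.1.face_unique ((k.2.2.2.1 f).trans hk) ((deck_onF k f).trans h)⟩

theorem Hom.IsUniversalCover.exists_face_over (hp : p.IsUniversalCover) (f : L.F) :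
    ∃ f' : K.F, p.onF f' = f := by
  obtain ⟨x, hx⟩ := hp.1.surj (L.base f)
  obtain ⟨f', ⟨-, h⟩, -⟩ := hp.1.liftF x f hx.symm
  exact ⟨f', h⟩

/-- Any 2-cell below whose boundary passes through the image of the edge `e` has a lift whose
boundary passes through `e`. -/
theorem Hom.IsUniversalCover.exists_face_through (hp : p.IsUniversalCover) {f : L.F} {e : K.E}
    (h : p.onE e ∈ L.bdry f) : ∃ f' : K.F, p.onF f' = f ∧ e ∈ K.bdry f' := by
  obtain ⟨f', rfl⟩ := hp.exists_face_over f
  rw [p.bdry_onF] at h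
  obtain ⟨e', he', h⟩ := List.mem_map.1 h
  obtain ⟨k, rfl⟩ := hp.exists_deck_edge h
  refine ⟨k.1.2.2 f', deck_onF k f', ?_⟩
  rw [k.2.2.2.2.1]
  exact List.mem_map_of_mem he'

end Deck

/-! ### Lifts of shortest essential loops -/

section Axis

variable {K M : TwoComplex.{u}} {p : Hom K M} {a : M.V} {g : List M.E} {γ : ℤ → K.E}

theorem IsShortestEssential.length_pos (hg : M.IsShortestEssential a g) : 0 < g.length := by
  rw [List.length_pos_iff]
  rintro rfl
  exact hg.essential ⟨rfl, .refl _⟩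

/-- A path from x to its translate projects to a closed path; were that null-homotopic, its lift
would close up and h would fix x, hence be trivial. -/
theorem IsShortestEssential.le_displacement (hg : M.IsShortestEssential a g)
    (hp : p.IsUniversalCover) {h : deck p} (hh : h ≠ 1) (x : K.V) :
    g.length ≤ K.vdist x (h.1.1 x) := by
  obtain ⟨l, hl, hl'⟩ := hp.connected.exists_path x (h.1.1 x)
  have h1 := p.map_isPath hl
  rw [deck_onV] at h1
  rw [← hl', ← List.length_map (f := p.onE)]
  refine hg.shortest _ _ h1 fun h2 => hh ?_
  exact hp.deck_eq (x := x) (hp.1.endsAt_unique ⟨l, hl, rfl⟩ (hp.nullHomotopic_iff.1 h2))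

theorem isPath_of_joined (hγ : ∀ n, K.tgt (γ n) = K.src (γ (n + 1))) (i : ℤ) (k : ℕ) :
    K.IsPath ((List.range k).map fun j : ℕ => γ (i + j)) (K.src (γ i)) (K.src (γ (i + k))) := by
  induction k with
  | zero => simp [isPath_nil]
  | succ k ih =>
    rw [List.range_succ, List.map_append, isPath_append]
    refine ⟨_, ih, rfl, ?_⟩
    change K.tgt (γ (i + k)) = _
    rw [hγ]
    push_cast
    rw [add_assoc]

theorem IsLift.map_segment (hγ : IsLift p g γ) :
    ((List.range g.length).map fun j : ℕ => γ (0 + j)).map p.onE = g := by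
  refine List.ext_getElem? fun i => ?_
  by_cases hi : i < g.length
  · have h := hγ.covers i
    rw [Int.emod_eq_of_lt (by positivity) (by exact_mod_cast hi), Int.toNat_natCast] at h
    rw [h]
    simp [hi]
  · rw [List.getElem?_eq_none (by simpa using hi), List.getElem?_eq_none (by simpa using hi)]

theorem IsLift.onE_add (hγ : IsLift p g γ) (n a : ℤ) :
    p.onE (γ (n + a * g.length)) = p.onE (γ n) := by
  have h := hγ.covers (n + a * g.length)
  rw [Int.add_mul_emod_self_right, hγ.covers n] at h
  exact (Option.some.inj h).symm

/-- The transformation taking `γ 0` to `γ L` is propagated along the axis in both directions by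
unique lifting of edges. -/
theorem IsLift.exists_translation (hγ : IsLift p g γ) (hp : p.IsUniversalCover) :
    ∃ τ : deck p, ∀ n : ℤ, τ.1.2.1 (γ n) = γ (n + g.length) := by
  have hon : ∀ n, p.onE (γ (n + g.length)) = p.onE (γ n) := fun n => by
    simpa using hγ.onE_add n 1
  obtain ⟨τ, hτ⟩ := hp.exists_deck_edge (hon 0).symm
  refine ⟨τ, fun n => ?_⟩
  induction n with
  | zero => exact hτ
  | succ n ih =>
    refine hp.1.edge_unique ?_ ((deck_onE _ _).trans (hon _).symm)
    rw [deck_src, ← hγ.joined, ← deck_tgt, ih, hγ.joined]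
    congr 2
    ring
  | pred n ih =>
    have h1 : K.rev (τ.1.2.1 (γ (-n - 1))) = K.rev (γ (-n - 1 + g.length)) := by
      refine hp.1.edge_unique ?_ ?_
      · change K.tgt _ = K.tgt _
        rw [deck_tgt, hγ.joined, hγ.joined, ← deck_src, sub_add_cancel, ih]
        congr 2
        ring
      · rw [← p.rev_onE, ← p.rev_onE, deck_onE, hon]
    rw [← K.rev_rev (τ.1.2.1 _), h1, K.rev_rev]

theorem translation_zpow {τ : deck p} {L : ℤ} (hτ : ∀ n : ℤ, τ.1.2.1 (γ n) = γ (n + L)) (a n : ℤ) :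
    (τ ^ a).1.2.1 (γ n) = γ (n + a * L) := by
  induction a with
  | zero => simp
  | succ a ih =>
    rw [zpow_add_one, (Commute.zpow_self τ a).eq]
    change τ.1.2.1 ((τ ^ (a : ℤ)).1.2.1 (γ n)) = _
    rw [ih, hτ]
    congr 1
    ring
  | pred a ih =>
    refine τ.1.2.1.injective ?_
    change (τ * τ ^ (-(a : ℤ) - 1)).1.2.1 (γ n) = _
    rw [← zpow_one_add, hτ, add_sub_cancel, ih]
    congr 1
    ring

theorem IsLift.base_eq (hγ : IsLift p g γ) (hg : M.IsShortestEssential a g) :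
    p.onV (K.src (γ 0)) = a := by
  have h := isPath_of_joined hγ.joined 0 g.length
  have h1 := p.map_isPath h
  rw [hγ.map_segment] at h1
  have h2 := hg.isPath
  cases g with
  | nil => exact absurd hg.length_pos (by simp)
  | cons e l => exact h1.1.symm.trans h2.1

theorem IsLift.endsAt (hγ : IsLift p g γ) : p.EndsAt (K.src (γ 0)) g (K.src (γ g.length)) := by
  refine ⟨_, ?_, hγ.map_segment⟩
  simpa using isPath_of_joined hγ.joined 0 g.length

theorem IsLift.translation_ne_one (hγ : IsLift p g γ) (hg : M.IsShortestEssential a g)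
    (hp : p.IsUniversalCover) {τ : deck p} (hτ : ∀ n : ℤ, τ.1.2.1 (γ n) = γ (n + g.length)) :
    τ ≠ 1 := by
  rintro rfl
  refine hg.essential ?_
  rw [← hγ.base_eq hg, hp.nullHomotopic_iff]
  have h := hγ.endsAt
  have h1 := hτ 0
  rw [zero_add] at h1
  rw [← h1] at h
  exact h

/-- A shortcut within one period would make the displacement of the translation smaller than L. -/
theorem IsLift.vdist_nat (hγ : IsLift p g γ) (hg : M.IsShortestEssential a g)
    (hp : p.IsUniversalCover) (i : ℤ) {k : ℕ} (hk : k ≤ g.length) :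
    K.vdist (K.src (γ i)) (K.src (γ (i + k))) = k := by
  obtain ⟨τ, hτ⟩ := hγ.exists_translation hp
  have hup : ∀ i (k : ℕ), K.vdist (K.src (γ i)) (K.src (γ (i + k))) ≤ k := fun i k => by
    simpa using vdist_le_length (isPath_of_joined hγ.joined i k)
  refine le_antisymm (hup i k) ?_
  have h1 := hg.le_displacement hp (hγ.translation_ne_one hg hp hτ) (K.src (γ i))
  rw [← deck_src, hτ] at h1
  have h2 := hp.connected.vdist_triangle (K.src (γ i)) (K.src (γ (i + k)))
    (K.src (γ (i + g.length)))
  have h3 := hup (i + k) (g.length - k)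
  rw [show i + (k : ℤ) + ((g.length - k : ℕ) : ℤ) = i + g.length by omega] at h3
  omega

theorem IsLift.vdist_int (hγ : IsLift p g γ) (hg : M.IsShortestEssential a g)
    (hp : p.IsUniversalCover) {i j : ℤ} (hk : (j - i).natAbs ≤ g.length) :
    K.vdist (K.src (γ i)) (K.src (γ j)) = (j - i).natAbs := by
  rcases le_total i j with h | h
  · have := hγ.vdist_nat hg hp i hk
    rwa [show i + ((j - i).natAbs : ℤ) = j by omega] at this
  · have := hγ.vdist_nat hg hp j hk
    rwa [show j + ((j - i).natAbs : ℤ) = i by omega, vdist_comm] at this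

theorem Hom.EndsAt.pow {h : deck p} {x : K.V}
    {l : List M.E} (hl : p.EndsAt x l (h.1.1 x)) (n : ℕ) :
    p.EndsAt x (List.replicate n l).flatten ((h ^ n).1.1 x) := by
  induction n with
  | zero => exact Hom.endsAt_nil.2 rfl
  | succ n ih =>
    rw [List.replicate_succ, List.flatten_cons, Hom.endsAt_append, pow_succ']
    exact ⟨_, hl, ih.translate h⟩

/-- A nonzero power equal to 1 would make a positive power of g null-homotopic. -/
theorem IsLift.zpow_translation_eq_one (hγ : IsLift p g γ) (hg : M.IsShortestEssential a g)
    (hp : p.IsUniversalCover) (htf : M.TorsionFreePi1) {τ : deck p}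
    (hτ : ∀ n : ℤ, τ.1.2.1 (γ n) = γ (n + g.length)) {b : ℤ} (hb : τ ^ b = 1) : b = 0 := by
  by_contra hb0
  obtain ⟨n, hn, hn1⟩ := isOfFinOrder_iff_pow_eq_one.1
    (isOfFinOrder_iff_zpow_eq_one.2 ⟨b, hb0, hb⟩)
  refine hg.essential (htf a g n hg.isPath hn ?_)
  rw [← hγ.base_eq hg, hp.nullHomotopic_iff]
  have h := hγ.endsAt
  rw [← zero_add (g.length : ℤ), ← hτ 0, deck_src] at h
  have h2 := Hom.EndsAt.pow h n
  rwa [hn1] at h2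

/-- Every integer is congruent to one of absolute value at most `L / 2`. -/
theorem exists_centered_residue (n : ℤ) {L : ℕ} (hL : 0 < L) :
    ∃ a b : ℤ, n = b + a * L ∧ 2 * b.natAbs ≤ L := by
  refine ⟨n.bdiv L, n.bmod L, ?_, ?_⟩
  · have := Int.bmod_add_bdiv n L
    rw [mul_comm] at this
    exact this.symm
  · have h1 := Int.le_bmod (x := n) hL
    have h2 := Int.bmod_lt (x := n) hL
    omega

/-- Reduce j - i modulo L to c with |c| ≤ L/2. The corresponding power of the translation moves `γ
i` by at most D + L/2 < L, so it is trivial and its exponent is 0; within one period the axis is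
geodesic. -/
theorem IsLift.natAbs_sub_le (hγ : IsLift p g γ) (hg : M.IsShortestEssential a g)
    (hp : p.IsUniversalCover) (htf : M.TorsionFreePi1) {i j : ℤ} {D : ℕ} (hD : 2 * D < g.length)
    (h : K.vdist (K.src (γ i)) (K.src (γ j)) ≤ D) : (j - i).natAbs ≤ D := by
  obtain ⟨τ, hτ⟩ := hγ.exists_translation hp
  obtain ⟨b, c, hbc, hc⟩ := exists_centered_residue (j - i) hg.length_pos
  obtain rfl : j = i + b * g.length + c := by linarith
  have h1 : K.vdist (K.src (γ (i + b * g.length + c))) (K.src (γ (i + b * g.length))) =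
      c.natAbs := by
    rw [vdist_comm, hγ.vdist_int hg hp] <;> rw [add_sub_cancel_left]
    omega
  have h2 := hp.connected.vdist_triangle (K.src (γ i)) (K.src (γ (i + b * g.length + c)))
    (K.src (γ (i + b * g.length)))
  have hb : b = 0 := by
    refine hγ.zpow_translation_eq_one hg hp htf hτ ?_
    by_contra hne
    have h3 := hg.le_displacement hp hne (K.src (γ i))
    rw [← deck_src, translation_zpow hτ] at h3
    omega
  subst hb
  rw [hγ.vdist_int hg hp (by simp; omega)] at h
  exact h

/-- The vertices at distance at most `r` from the lift `γ`. -/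
def axisNbhd (γ : ℤ → K.E) (r : ℕ) : Set K.V := K.nbhd (Set.range fun n => K.src (γ n)) r

theorem mem_axisNbhd {r : ℕ} {x : K.V} :
    x ∈ axisNbhd γ r ↔ ∃ n, K.vdist x (K.src (γ n)) ≤ r := by
  simp [axisNbhd, nbhd]

/-- Going from the translate of `γ i` through that of x to `γ j`, and then by at most L/2 along the
axis to a translate of `γ i` by a power of τ, costs at most 2r + L/2 < L. So h and this power of τ
agree by the displacement bound. -/
theorem IsLift.mem_zpowers (hγ : IsLift p g γ) (hg : M.IsShortestEssential a g)
    (hp : p.IsUniversalCover) {τ : deck p} (hτ : ∀ n : ℤ, τ.1.2.1 (γ n) = γ (n + g.length))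
    {r : ℕ} (hr : 4 * r < g.length) {h : deck p} {x : K.V} (hx : x ∈ axisNbhd γ r)
    (hhx : h.1.1 x ∈ axisNbhd γ r) : h ∈ Subgroup.zpowers τ := by
  obtain ⟨i, hi⟩ := mem_axisNbhd.1 hx
  obtain ⟨j, hj⟩ := mem_axisNbhd.1 hhx
  obtain ⟨b, c, hbc, hc⟩ := exists_centered_residue (j - i) hg.length_pos
  obtain rfl : j = i + b * g.length + c := by linarith
  have h1 : K.vdist (K.src (γ (i + b * g.length + c))) (K.src (γ (i + b * g.length))) =
      c.natAbs := by
    rw [vdist_comm, hγ.vdist_int hg hp] <;> rw [add_sub_cancel_left]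
    omega
  have hK := hp.connected
  have h2 := hK.vdist_triangle (h.1.1 (K.src (γ i))) (h.1.1 x) (K.src (γ (i + b * g.length)))
  have h3 := hK.vdist_triangle (h.1.1 x) (K.src (γ (i + b * g.length + c)))
    (K.src (γ (i + b * g.length)))
  rw [hK.deck_vdist, vdist_comm] at h2
  refine Subgroup.mem_zpowers_iff.2 ⟨b, ?_⟩
  by_contra hne
  have h4 := hg.le_displacement hp (h := h⁻¹ * τ ^ b)
    (fun h5 => hne (inv_mul_eq_one.1 h5).symm) (K.src (γ i))
  rw [← hK.deck_vdist h, deck_mul_apply, deck_apply_inv, ← deck_src (τ ^ b),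
    translation_zpow hτ] at h4
  rw [vdist_comm (K.src (γ i)) x, vdist_comm _ (h.1.1 (K.src (γ i)))] at h2
  omega

end Axis

/-! ### Geodesics in the 1-skeleton of a hyperbolic complex -/

section Hyperbolic

variable {K : TwoComplex.{u}}

/-- The distance of a point of the 1-skeleton from the vertex `x`. -/
noncomputable def ptDist (K : TwoComplex.{u}) (x : K.V) (q : K.Point) : ℝ :=
  min ((q.2 : ℝ) + K.vdist (K.src q.1) x) ((1 - (q.2 : ℝ)) + K.vdist (K.tgt q.1) x)

theorem pdist_le_pdistThrough (q q' : K.Point) : K.pdist q q' ≤ K.pdistThrough q q' := by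
  unfold pdist
  split_ifs
  · exact min_le_right _ _
  · exact min_le_right _ _
  · exact le_rfl

theorem pdistThrough_comm (q q' : K.Point) : K.pdistThrough q q' = K.pdistThrough q' q := by
  unfold pdistThrough
  rw [min_min_min_comm]
  simp only [vdist_comm (K.src q.1), vdist_comm (K.tgt q.1), add_comm, add_left_comm]

theorem pdist_comm (q q' : K.Point) : K.pdist q q' = K.pdist q' q := by
  unfold pdist
  rw [pdistThrough_comm q q']
  by_cases h : q'.1 = q.1
  · rw [if_pos h, if_pos h.symm, abs_sub_comm]
  · rw [if_neg h, if_neg (Ne.symm h)]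
    have h' : q'.1 = K.rev q.1 ↔ q.1 = K.rev q'.1 := by rw [← K.rev_eq_iff, eq_comm]
    by_cases h2 : q'.1 = K.rev q.1
    · rw [if_pos h2, if_pos (h'.1 h2)]
      congr 2
      ring
    · rw [if_neg h2, if_neg (fun h3 => h2 (h'.2 h3))]

theorem pdist_nonneg (q q' : K.Point) : 0 ≤ K.pdist q q' := by
  have h1 := q.2.2.1
  have h2 := q.2.2.2
  have h3 := q'.2.2.1
  have h4 := q'.2.2.2
  have h : 0 ≤ K.pdistThrough q q' := by
    unfold pdistThrough
    refine le_min (le_min ?_ ?_) (le_min ?_ ?_) <;>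
    · have := fun a b => Nat.cast_nonneg (α := ℝ) (K.vdist a b)
      refine add_nonneg (add_nonneg ?_ (this _ _)) ?_ <;> linarith
  unfold pdist
  split_ifs
  · exact le_min (abs_nonneg _) h
  · exact le_min (abs_nonneg _) h
  · exact h

/-- The triangle inequality with a vertex as third point is the only one for points of the
1-skeleton that the estimates below require. -/
theorem Connected.ptDist_le (hK : K.Connected) (x : K.V) (q q' : K.Point) :
    K.ptDist x q ≤ K.pdist q q' + K.ptDist x q' := by
  obtain ⟨e, t, ht0, ht1⟩ := q
  obtain ⟨e', t', ht0', ht1'⟩ := q'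
  have tri : ∀ a b : K.V, (K.vdist a x : ℝ) ≤ K.vdist a b + K.vdist b x := fun a b => by
    exact_mod_cast hK.vdist_triangle a b x
  have h1 : ∀ e : K.E, (K.vdist (K.src e) x : ℝ) ≤ 1 + K.vdist (K.tgt e) x := fun e => by
    have h := tri (K.src e) (K.tgt e)
    have h' : (K.vdist (K.src e) (K.tgt e) : ℝ) ≤ 1 := by exact_mod_cast vdist_src_tgt e
    linarith
  have h2 : ∀ e : K.E, (K.vdist (K.tgt e) x : ℝ) ≤ 1 + K.vdist (K.src e) x := fun e => by
    have h := h1 (K.rev e)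
    rwa [tgt_rev] at h
  have hA : K.ptDist x (e, ⟨t, ht0, ht1⟩) ≤ t + K.vdist (K.src e) x := min_le_left _ _
  have hB : K.ptDist x (e, ⟨t, ht0, ht1⟩) ≤ (1 - t) + K.vdist (K.tgt e) x := min_le_right _ _
  have hthrough : K.ptDist x (e, ⟨t, ht0, ht1⟩) ≤
      K.pdistThrough (e, ⟨t, ht0, ht1⟩) (e', ⟨t', ht0', ht1'⟩) +
        K.ptDist x (e', ⟨t', ht0', ht1'⟩) := by
    rw [← sub_le_iff_le_add]
    have hC : K.vdist (K.src e') x - t' ≤ K.ptDist x (e', ⟨t', ht0', ht1'⟩) :=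
      le_min (by simp only; linarith) (by have := h1 e'; simp only; linarith)
    have hD : K.vdist (K.tgt e') x - (1 - t') ≤ K.ptDist x (e', ⟨t', ht0', ht1'⟩) :=
      le_min (by have := h2 e'; simp only; linarith) (by simp only; linarith)
    unfold pdistThrough
    refine le_min (le_min ?_ ?_) (le_min ?_ ?_) <;> simp only
    · have := tri (K.src e) (K.src e'); linarith
    · have := tri (K.src e) (K.tgt e'); linarith
    · have := tri (K.tgt e) (K.src e'); linarith
    · have := tri (K.tgt e) (K.tgt e'); linarith
  unfold pdist
  split_ifs with h h'
  · rw [min_add]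
    refine le_min ?_ hthrough
    simp only at h
    subst h
    rw [← sub_le_iff_le_add']
    have ha := le_abs_self (t - t')
    have hb := neg_abs_le (t - t')
    refine le_min ?_ ?_ <;> simp only <;> linarith
  · rw [min_add]
    refine le_min ?_ hthrough
    simp only at h'
    subst h'
    rw [← sub_le_iff_le_add']
    have ha := le_abs_self (t - (1 - t'))
    have hb := neg_abs_le (t - (1 - t'))
    refine le_min ?_ ?_ <;> simp only [tgt_rev]
    · change _ ≤ t' + (K.vdist (K.tgt e) x : ℝ)
      linarith
    · linarith
  · exact hthrough

/-- The point `q` of the 1-skeleton is the vertex `v`. -/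
def IsVertex (q : K.Point) (v : K.V) : Prop :=
  ((q.2 : ℝ) = 0 ∧ K.src q.1 = v) ∨ ((q.2 : ℝ) = 1 ∧ K.tgt q.1 = v)

theorem IsVertex.pdist_le {q q' : K.Point} {v w : K.V} (h : IsVertex q v) (h' : IsVertex q' w) :
    K.pdist q q' ≤ K.vdist v w := by
  refine (pdist_le_pdistThrough q q').trans ?_
  unfold pdistThrough
  rcases h with ⟨h, rfl⟩ | ⟨h, rfl⟩ <;> rcases h' with ⟨h', rfl⟩ | ⟨h', rfl⟩ <;>
    simp only [h, h', min_le_iff] <;> simp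

theorem IsVertex.pdist_eq_zero {q q' : K.Point} {v : K.V} (h : IsVertex q v) (h' : IsVertex q' v) :
    K.pdist q q' = 0 := by
  refine le_antisymm ?_ (pdist_nonneg _ _)
  have := h.pdist_le h'
  rwa [vdist_self, Nat.cast_zero] at this

theorem Connected.ptDist_of_isVertex (hK : K.Connected) {q : K.Point} {v : K.V} (h : IsVertex q v)
    (x : K.V) : K.ptDist x q = K.vdist v x := by
  have h1 : ∀ e : K.E, (K.vdist (K.src e) x : ℝ) ≤ 1 + K.vdist (K.tgt e) x := fun e => by
    have h := hK.vdist_triangle (K.src e) (K.tgt e) x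
    have h' := vdist_src_tgt e
    exact_mod_cast h.trans (by omega)
  have h2 := h1 (K.rev q.1)
  rw [tgt_rev] at h2
  unfold ptDist
  rcases h with ⟨h, rfl⟩ | ⟨h, rfl⟩ <;> rw [h]
  · rw [min_eq_left] <;> simp
    exact h1 q.1
  · rw [min_eq_right] <;> simp
    exact h2

/-- `c` is a geodesic of length `a` from the vertex `u` to the vertex `v`. -/
structure IsGeodesicFromTo (c : ℝ → K.Point) (a : ℝ) (u v : K.V) : Prop where
  isGeodesic : K.IsGeodesic c a
  source : IsVertex (c 0) u
  target : IsVertex (c a) v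

theorem IsGeodesicFromTo.reverse {c : ℝ → K.Point} {a : ℝ} {u v : K.V}
    (h : IsGeodesicFromTo c a u v) : IsGeodesicFromTo (fun t => c (a - t)) a v u := by
  refine ⟨⟨h.1.1, fun s hs t ht => ?_⟩, by simpa using h.target, by simpa using h.source⟩
  rw [h.1.2 _ ⟨by linarith [hs.2], by linarith [hs.1]⟩ _ ⟨by linarith [ht.2], by linarith [ht.1]⟩,
    sub_sub_sub_cancel_left, abs_sub_comm]

theorem IsGeodesicFromTo.le_vdist {c : ℝ → K.Point} {a : ℝ} {u v : K.V}
    (h : IsGeodesicFromTo c a u v) : a ≤ K.vdist u v := by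
  have h1 := h.source.pdist_le h.target
  have h0 := h.1.1
  rw [h.1.2 0 ⟨le_rfl, h0⟩ a ⟨h0, le_rfl⟩, zero_sub, abs_neg, abs_of_nonneg h0] at h1
  exact h1

/-- All geodesics from `u` to `v` stay at distance at least `d` from `x`. -/
def FarFrom (x : K.V) (d : ℝ) (u v : K.V) : Prop :=
  ∀ c a, IsGeodesicFromTo c a u v → ∀ t ∈ Set.Icc 0 a, d ≤ K.ptDist x (c t)

theorem FarFrom.symm {x u v : K.V} {d : ℝ} (h : FarFrom x d u v) : FarFrom x d v u := by
  intro c a hc t ht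
  have := h _ a hc.reverse (a - t) ⟨by linarith [ht.2], by linarith [ht.1]⟩
  simpa using this

theorem FarFrom.mono {x u v : K.V} {d d' : ℝ} (h : FarFrom x d u v) (hd : d' ≤ d) :
    FarFrom x d' u v := fun c a hc t ht => hd.trans (h c a hc t ht)

/-- Consecutive edges `η 0, …, η n`, with initial vertices at the right distances from the first
one, give a geodesic from the initial vertex of `η 0` to that of `η n`. -/
theorem Connected.exists_isGeodesicFromTo_of_edges (hK : K.Connected) (η : ℕ → K.E) (n : ℕ)
    (hη : ∀ k < n, K.tgt (η k) = K.src (η (k + 1)))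
    (hd : ∀ k ≤ n, K.vdist (K.src (η k)) (K.src (η 0)) = k) :
    ∃ c, IsGeodesicFromTo c n (K.src (η 0)) (K.src (η n)) ∧
      ∀ k : ℕ, k ≤ n → IsVertex (c k) (K.src (η k)) := by
  have hfr : ∀ t : ℝ, 0 ≤ t → Int.fract t = t - ⌊t⌋₊ := fun t ht => by
    rw [← Int.self_sub_floor, natCast_floor_eq_intCast_floor ht]
  -- At t = n this is the point of `η n` with parameter 0, which is why an edge issuing from the
  -- last vertex has to be supplied.
  let c : ℝ → K.Point := fun t => (η ⌊t⌋₊, ⟨Int.fract t, Int.fract_nonneg t, (Int.fract_lt_one t).le⟩)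
  have hcv : ∀ k : ℕ, IsVertex (c k) (K.src (η k)) := fun k => Or.inl (by simp [c])
  have hstep : ∀ i k, i + k ≤ n → K.vdist (K.src (η i)) (K.src (η (i + k))) ≤ k := by
    intro i k
    induction k with
    | zero => simp [vdist_self]
    | succ k ih =>
      intro h
      have h1 := hK.vdist_triangle (K.src (η i)) (K.src (η (i + k))) (K.src (η (i + k + 1)))
      have h2 := vdist_src_tgt (η (i + k))
      rw [hη _ (by omega)] at h2
      have h3 := ih (by omega)
      rw [← add_assoc]
      omega
  -- Exact distances from the initial vertex yield the lower bound for `pdist` on the path, since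
  -- `ptDist` is 1-Lipschitz; `hup` is the upper bound.
  have hD : ∀ t ∈ Set.Icc (0 : ℝ) n, K.ptDist (K.src (η 0)) (c t) = t := by
    rintro t ⟨h0, h1⟩
    have hk : ⌊t⌋₊ ≤ n := Nat.floor_le_of_le h1
    have hfl := Nat.floor_le h0
    have hlt := Nat.lt_floor_add_one t
    simp only [ptDist, c, hd _ hk, hfr t h0]
    rw [sub_add_cancel]
    refine min_eq_left ?_
    rcases hk.lt_or_eq with h2 | h2
    · rw [hη _ h2, hd _ h2]
      push_cast
      linarith
    · have h3 := hK.vdist_triangle (K.src (η ⌊t⌋₊)) (K.tgt (η ⌊t⌋₊)) (K.src (η 0))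
      have h4 := vdist_src_tgt (η ⌊t⌋₊)
      rw [hd _ hk] at h3
      have h5 : (⌊t⌋₊ : ℝ) ≤ 1 + K.vdist (K.tgt (η ⌊t⌋₊)) (K.src (η 0)) := by
        exact_mod_cast h3.trans (by omega)
      have h6 : t = ⌊t⌋₊ := le_antisymm (h2 ▸ h1) hfl
      linarith
  have hup : ∀ s t : ℝ, 0 ≤ s → s ≤ t → t ≤ n → K.pdist (c s) (c t) ≤ t - s := by
    intro s t h0 hst hn
    have hfl := Nat.floor_mono hst
    rcases hfl.eq_or_lt with h | h
    · have h1 : (c t).1 = (c s).1 := by simp only [c, h]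
      unfold pdist
      rw [if_pos h1]
      refine (min_le_left _ _).trans ?_
      simp only [c, hfr s h0, hfr t (h0.trans hst), h]
      rw [abs_sub_comm, sub_sub_sub_cancel_right, abs_of_nonneg (by linarith)]
    · refine (pdist_le_pdistThrough _ _).trans ?_
      have hk : ⌊t⌋₊ ≤ n := Nat.floor_le_of_le hn
      refine (min_le_right _ _).trans ((min_le_left _ _).trans ?_)
      simp only [c, hfr s h0, hfr t (h0.trans hst)]
      obtain ⟨k, hk'⟩ := Nat.exists_eq_add_of_lt h
      have h2 := hstep (⌊s⌋₊ + 1) k (by omega)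
      rw [← hη _ (by omega), show ⌊s⌋₊ + 1 + k = ⌊t⌋₊ by omega] at h2
      have h3 : (K.vdist (K.tgt (η ⌊s⌋₊)) (K.src (η ⌊t⌋₊)) : ℝ) ≤ k := by exact_mod_cast h2
      have h4 : (⌊t⌋₊ : ℝ) = ⌊s⌋₊ + k + 1 := by exact_mod_cast hk'
      linarith
  have hgeo : ∀ s t : ℝ, 0 ≤ s → s ≤ t → t ≤ n → K.pdist (c s) (c t) = t - s := by
    intro s t h0 hst hn
    refine le_antisymm (hup s t h0 hst hn) ?_
    have h1 := hK.ptDist_le (K.src (η 0)) (c t) (c s)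
    rw [hD t ⟨h0.trans hst, hn⟩, hD s ⟨h0, hst.trans hn⟩, pdist_comm] at h1
    linarith
  refine ⟨c, ⟨⟨Nat.cast_nonneg n, fun s hs t ht => ?_⟩, by simpa using hcv 0, hcv n⟩,
    fun k _ => hcv k⟩
  rcases le_total s t with h | h
  · rw [hgeo s t hs.1 h ht.2, abs_sub_comm, abs_of_nonneg (by linarith)]
  · rw [pdist_comm, hgeo t s ht.1 h hs.2, abs_of_nonneg (by linarith)]

theorem IsPath.exists_edges (hE : ∀ v : K.V, ∃ e, K.src e = v) {l : List K.E} {u v : K.V}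
    (h : K.IsPath l u v) : ∃ η : ℕ → K.E, K.src (η 0) = u ∧ K.src (η l.length) = v ∧
      (∀ k < l.length, K.tgt (η k) = K.src (η (k + 1))) ∧
      ∀ k < l.length, l[k]? = some (η k) := by
  induction l generalizing u with
  | nil =>
    obtain ⟨e, he⟩ := hE u
    exact ⟨fun _ => e, he, he.trans h, by simp, by simp⟩
  | cons e l ih =>
    obtain ⟨η, h1, h2, h3, h4⟩ := ih h.2
    refine ⟨fun k => Nat.casesOn k e η, h.1, h2, fun k hk => ?_, fun k hk => ?_⟩
    · cases k with
      | zero => exact h1.symm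
      | succ k => exact h3 k (by simpa using hk)
    · cases k with
      | zero => rfl
      | succ k => exact h4 k (by simpa using hk)

theorem Connected.exists_isGeodesicFromTo (hK : K.Connected) (hE : ∀ v : K.V, ∃ e, K.src e = v)
    (u v : K.V) : ∃ c a, IsGeodesicFromTo c a u v := by
  obtain ⟨l, hl, hl'⟩ := hK.exists_path u v
  obtain ⟨η, rfl, rfl, h, -⟩ := hl.exists_edges hE
  have h1 : ∀ i k, i + k ≤ l.length → K.vdist (K.src (η i)) (K.src (η (i + k))) ≤ k := by
    intro i k
    induction k with
    | zero => simp [vdist_self]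
    | succ k ih =>
      intro h0
      have h1 := hK.vdist_triangle (K.src (η i)) (K.src (η (i + k))) (K.src (η (i + k + 1)))
      have h2 := vdist_src_tgt (η (i + k))
      rw [h _ (by omega)] at h2
      have h3 := ih (by omega)
      rw [← add_assoc]
      omega
  obtain ⟨c, hc, -⟩ := hK.exists_isGeodesicFromTo_of_edges η l.length h fun k hk => by
    have h2 := h1 0 k (by omega)
    have h3 := h1 k (l.length - k) (by omega)
    have h4 := hK.vdist_triangle (K.src (η 0)) (K.src (η k)) (K.src (η l.length))
    rw [zero_add] at h2
    rw [show k + (l.length - k) = l.length by omega] at h3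
    rw [vdist_comm]
    omega
  exact ⟨c, _, hc⟩

/-- Every point of the third side of a geodesic triangle is within δ of the other two. Quantifying
over all geodesics in `FarFrom` lets this be iterated and finally applied to a prescribed geodesic.
-/
theorem IsHyperbolic.farFrom_trans {δ : ℝ} (hδ : K.IsHyperbolic δ) (hK : K.Connected)
    (hE : ∀ v : K.V, ∃ e, K.src e = v) {x u v w : K.V} {d : ℝ} (h : FarFrom x d u v)
    (h' : FarFrom x d v w) : FarFrom x (d - δ) u w := by
  intro c a hc t ht
  obtain ⟨c₂, a₂, hc₂⟩ := hK.exists_isGeodesicFromTo hE w v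
  obtain ⟨c₃, a₃, hc₃⟩ := hK.exists_isGeodesicFromTo hE v u
  rcases hδ c c₂ c₃ a a₂ a₃ hc.1 hc₂.1 hc₃.1 (hc.target.pdist_eq_zero hc₂.source)
    (hc₂.target.pdist_eq_zero hc₃.source) (hc₃.target.pdist_eq_zero hc.source) t ht with
    ⟨s, hs, hst⟩ | ⟨s, hs, hst⟩
  · have h1 := h'.symm _ _ hc₂ s hs
    have h2 := hK.ptDist_le x (c₂ s) (c t)
    rw [pdist_comm] at h2
    linarith
  · have h1 := h.symm _ _ hc₃ s hs
    have h2 := hK.ptDist_le x (c₃ s) (c t)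
    rw [pdist_comm] at h2
    linarith

theorem Connected.farFrom_of_vdist_le_one (hK : K.Connected) {x u v : K.V} {d : ℝ}
    (huv : K.vdist u v ≤ 1) (hu : d ≤ K.vdist u x) : FarFrom x (d - 1) u v := by
  intro c a hc t ht
  have h1 := hK.ptDist_le x (c 0) (c t)
  have h2 : a ≤ 1 := hc.le_vdist.trans (by exact_mod_cast huv)
  rw [hK.ptDist_of_isVertex hc.source, hc.1.2 0 ⟨le_rfl, hc.1.1⟩ t ht, zero_sub, abs_neg,
    abs_of_nonneg ht.1] at h1
  linarith [ht.2]

/-- Geodesics between the end points of short paths away from `x` stay away from `x`. -/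
theorem IsHyperbolic.farFrom_of_chain {δ : ℝ} (hδ : K.IsHyperbolic δ) (hK : K.Connected)
    (hE : ∀ v : K.V, ∃ e, K.src e = v) {x : K.V} {d : ℝ} (k : ℕ) :
    ∀ (y : ℕ → K.V) (m : ℕ), m ≤ 2 ^ k → (∀ i < m, K.vdist (y i) (y (i + 1)) ≤ 1) →
      (∀ i ≤ m, d ≤ K.vdist (y i) x) → FarFrom x (d - 1 - k * δ) (y 0) (y m) := by
  induction k with
  | zero =>
    intro y m hm h1 h2
    refine (hK.farFrom_of_vdist_le_one ?_ (h2 0 (Nat.zero_le m))).mono (by simp)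
    rcases Nat.le_one_iff_eq_zero_or_eq_one.1 (by simpa using hm) with rfl | rfl
    · simp [vdist_self]
    · exact h1 0 one_pos
  | succ k ih =>
    intro y m hm h1 h2
    rw [pow_succ] at hm
    -- Bisect the chain: each doubling of its length costs one thin triangle, that is δ.
    have h3 := ih y (m / 2) (by omega) (fun i hi => h1 i (by omega)) fun i hi => h2 i (by omega)
    have h4 := ih (fun i => y (m / 2 + i)) (m - m / 2) (by omega)
      (fun i hi => h1 (m / 2 + i) (by omega)) fun i hi => h2 (m / 2 + i) (by omega)
    simp only [add_zero, show m / 2 + (m - m / 2) = m by omega] at h4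
    refine (hδ.farFrom_trans hK hE h3 h4).mono (le_of_eq ?_)
    push_cast
    ring

/-- A geodesic from `v` to a vertex `y`, which is not nearer to `x` than to `v`, stays away
from `x`. -/
theorem Connected.farFrom_of_nearest (hK : K.Connected) {x v y : K.V}
    (h : K.vdist v y ≤ K.vdist x y) : FarFrom x ((K.vdist v x : ℝ) / 2) v y := by
  intro c a hc t ht
  have h0 := hc.1.1
  -- The point at time t is at distance at least d(v, x) - t from x, and also at least t because a ≤
  -- d(v, y) ≤ d(x, y). The average of the two bounds is d(v, x) / 2.
  have h1 := hK.ptDist_le x (c 0) (c t)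
  have h2 := hK.ptDist_le x (c a) (c t)
  rw [hK.ptDist_of_isVertex hc.source, hc.1.2 0 ⟨le_rfl, h0⟩ t ht, zero_sub, abs_neg,
    abs_of_nonneg ht.1] at h1
  rw [hK.ptDist_of_isVertex hc.target, hc.1.2 a ⟨h0, le_rfl⟩ t ht,
    abs_of_nonneg (by linarith [ht.2]), vdist_comm] at h2
  have h3 := hc.le_vdist
  have h4 : (K.vdist v y : ℝ) ≤ K.vdist x y := by exact_mod_cast h
  linarith

/-- `n` is the index of a vertex of `γ` nearest to `y`. -/
def IsNearest (γ : ℤ → K.E) (y : K.V) (n : ℤ) : Prop :=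
  ∀ i, K.vdist (K.src (γ n)) y ≤ K.vdist (K.src (γ i)) y

theorem exists_isNearest (γ : ℤ → K.E) (y : K.V) : ∃ n, IsNearest γ y n := by
  obtain ⟨n, hn⟩ : ∃ n, ∀ i, K.vdist (K.src (γ n)) y ≤ K.vdist (K.src (γ i)) y := by
    refine ⟨Function.argmin (fun n => K.vdist (K.src (γ n)) y), fun i => ?_⟩
    exact Function.argmin_le (fun n => K.vdist (K.src (γ n)) y) i
  exact ⟨n, hn⟩

/-- The nearest points on a local geodesic `γ` of two vertices, connected by geodesics which are
far away from `γ`, are near to each other. -/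
theorem IsHyperbolic.nearest_sub_le {δ : ℝ} (hδ : K.IsHyperbolic δ) (hδ0 : 0 ≤ δ)
    (hK : K.Connected) (hE : ∀ v : K.V, ∃ e, K.src e = v) {γ : ℤ → K.E} {L : ℕ}
    (hγ : ∀ n, K.tgt (γ n) = K.src (γ (n + 1)))
    (hL : ∀ (i : ℤ) (k : ℕ), k ≤ L → K.vdist (K.src (γ i)) (K.src (γ (i + k))) = k)
    {y y' : K.V} {i j : ℤ} (hi : IsNearest γ y i) (hj : IsNearest γ y' j)
    (hij : (j - i).natAbs ≤ L) {d : ℝ} (hd : 2 * δ < d)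
    (hfar : ∀ n, FarFrom (K.src (γ n)) d y y') : ((j - i).natAbs : ℝ) ≤ 8 * δ + 1 := by
  wlog h : i ≤ j generalizing i j y y'
  · rw [← Int.natAbs_neg, neg_sub] at hij ⊢
    exact this hj hi hij (fun n => (hfar n).symm) (le_of_not_ge h)
  obtain ⟨n, rfl⟩ := Int.le.dest h
  simp only [add_sub_cancel_left, Int.natAbs_natCast] at hij ⊢
  by_contra! hn
  obtain ⟨c, hc, hcv⟩ := hK.exists_isGeodesicFromTo_of_edges (fun k => γ (i + k)) n
    (fun k _ => by simp only [hγ]; push_cast; rw [add_assoc])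
    (fun k hk => by
      have := hL i k (hk.trans hij)
      simpa [vdist_comm] using this)
  simp only [Nat.cast_zero, add_zero] at hc
  -- The middle of the axis segment is on the fourth side of a quadrilateral whose other three sides
  -- stay away from it, so if n is too large the thin triangles give it a positive distance from
  -- itself.
  set x := K.src (γ (i + (n / 2 : ℕ))) with hx
  have hxi : K.vdist (K.src (γ i)) x = n / 2 := hL i (n / 2) (by omega)
  have hxj : K.vdist (K.src (γ (i + n))) x = n - n / 2 := by
    have := hL (i + (n / 2 : ℕ)) (n - n / 2) (by omega)
    rwa [add_assoc, ← Nat.cast_add, show n / 2 + (n - n / 2) = n by omega, ← hx, vdist_comm] at this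
  have h1 := hK.farFrom_of_nearest (hi (i + (n / 2 : ℕ)))
  have h2 := (hK.farFrom_of_nearest (hj (i + (n / 2 : ℕ)))).symm
  rw [← hx, hxi] at h1
  rw [← hx, hxj] at h2
  have h3 : (n : ℝ) ≤ 2 * (n / 2 : ℕ) + 1 := by exact_mod_cast (by omega : n ≤ 2 * (n / 2) + 1)
  have h4 : ((n / 2 : ℕ) : ℝ) ≤ (n - n / 2 : ℕ) := by exact_mod_cast (by omega : n / 2 ≤ n - n / 2)
  -- Two triangles fill the quadrilateral, so 2δ is lost; n > 8δ + 1 makes half of ⌊n/2⌋ larger than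
  -- that.
  have h5 := hδ.farFrom_trans hK hE (hδ.farFrom_trans hK hE (d := min d ((n / 2 : ℕ) / 2 : ℝ))
    (h1.mono (min_le_right _ _)) ((hfar _).mono (min_le_left _ _)))
    (h2.mono ((sub_le_self _ hδ0).trans ((min_le_right _ _).trans (by linarith))))
  have h6 := h5 c n hc (n / 2 : ℕ) ⟨Nat.cast_nonneg _, by exact_mod_cast Nat.div_le_self n 2⟩
  rw [hK.ptDist_of_isVertex (hcv _ (Nat.div_le_self n 2)), vdist_self, Nat.cast_zero] at h6
  have h7 : 2 * δ < min d ((n / 2 : ℕ) / 2 : ℝ) := lt_min hd (by linarith)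
  linarith

end Hyperbolic

/-! ### An equivariant potential on the tube around a lift -/

section Potential

variable {K M : TwoComplex.{u}} {p : Hom K M} {a : M.V} {g : List M.E} {γ : ℤ → K.E} {δ : ℝ}
  {r d k B : ℕ}

theorem Connected.exists_src_eq (hK : K.Connected) (e : K.E) (v : K.V) : ∃ e', K.src e' = v := by
  obtain ⟨l, hl⟩ := hK v (K.src e)
  cases l with
  | nil => exact ⟨e, hl.symm⟩
  | cons e' l => exact ⟨e', hl.1⟩

/-- Lift one period, let τ carry its start to its end, and move edge n mod L of that period by τ to
the power ⌊n / L⌋. -/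
theorem Hom.IsUniversalCover.exists_isLift (hp : p.IsUniversalCover) (hg : M.IsPath g a a)
    (hg0 : 0 < g.length) : ∃ γ : ℤ → K.E, IsLift p g γ := by
  obtain ⟨x, rfl⟩ := hp.1.surj a
  obtain ⟨y, ⟨l, hl, rfl⟩, hy⟩ := hp.1.exists_endsAt hg
  obtain ⟨τ, rfl⟩ := hp.exists_deck hy.symm
  have hE : ∀ v : K.V, ∃ e, K.src e = v := by
    cases l with
    | nil => simp at hg0
    | cons e l => exact hp.connected.exists_src_eq e
  obtain ⟨η, h1, h2, h3, h4⟩ := hl.exists_edges hE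
  rw [List.length_map] at hg0
  have hL0 : (0 : ℤ) < l.length := by exact_mod_cast hg0
  refine ⟨fun n => (τ ^ (n / l.length)).1.2.1 (η (n % l.length).toNat), fun n => ?_, fun n => ?_⟩
  · have hr0 := Int.emod_nonneg n hL0.ne'
    have hr1 := Int.emod_lt_of_pos n hL0
    have hn := Int.emod_add_mul_ediv n l.length
    set q := n / (l.length : ℤ)
    set r := n % (l.length : ℤ)
    simp only [deck_tgt, deck_src]
    rw [h3 _ (by omega)]
    rcases (show r + 1 ≤ l.length by omega).lt_or_eq with h | h
    · obtain ⟨h5, h6⟩ := (Int.ediv_emod_unique (a := n + 1) (r := r + 1) (q := q) hL0).2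
        ⟨by linarith, by omega, h⟩
      rw [h5, h6, show (r + 1).toNat = r.toNat + 1 by omega]
    · obtain ⟨h5, h6⟩ := (Int.ediv_emod_unique (a := n + 1) (r := 0) (q := q + 1) hL0).2
        ⟨by linarith, le_rfl, hL0⟩
      rw [h5, h6, show r.toNat + 1 = l.length by omega, h2, zpow_add_one]
      change _ = (τ ^ q).1.1 (τ.1.1 (K.src (η 0)))
      rw [h1]
  · have hr0 := Int.emod_nonneg n hL0.ne'
    have hr1 := Int.emod_lt_of_pos n hL0
    simp only [List.length_map, deck_onE, List.getElem?_map]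
    rw [h4 _ (by omega)]
    rfl

/-- The tube of radius `r` around a lift of a shortest essential loop, in a hyperbolic universal
covering, with the parameters for the estimates: a part of the tube at distance at least `d` from
the axis, the exponent `k` and a bound `B` for the distance of projections to the axis. -/
structure HyperbolicTube (p : Hom K M) (a : M.V) (g : List M.E) (γ : ℤ → K.E) (δ : ℝ)
    (r d k B : ℕ) : Prop where
  cover : p.IsUniversalCover
  torsionFree : M.TorsionFreePi1
  shortest : M.IsShortestEssential a g
  lift : IsLift p g γ
  hyperbolic : K.IsHyperbolic δ
  nonneg : 0 ≤ δ
  le_bound : 8 * δ + 1 ≤ B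
  lt_length : B + 2 * (2 * r + 1) < g.length
  lt_depth : 2 * δ + k * δ + 1 < d

/-- The part of the tube of radius `r` that lies at distance at least `d` from the axis. -/
def outerTube (γ : ℤ → K.E) (r d : ℕ) : Set K.V :=
  {y | y ∈ axisNbhd γ r ∧ ∀ n, d ≤ K.vdist y (K.src (γ n))}

theorem IsNearest.vdist_le {y : K.V} {n : ℤ} (h : IsNearest γ y n) (hy : y ∈ axisNbhd γ r) :
    K.vdist (K.src (γ n)) y ≤ r := by
  obtain ⟨i, hi⟩ := mem_axisNbhd.1 hy
  rw [vdist_comm] at hi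
  exact (h i).trans hi

namespace HyperbolicTube

/-- The path through y and y' joins the two projections by at most 2r + 1 steps, less than L/2 by
`lt_length`. This crude bound serves as the a priori estimate for the sharper one. -/
theorem natAbs_sub_le (hT : HyperbolicTube p a g γ δ r d k B) {y y' : K.V} {i j : ℤ}
    (hy : y ∈ axisNbhd γ r) (hy' : y' ∈ axisNbhd γ r) (hyy : K.vdist y y' ≤ 1)
    (hi : IsNearest γ y i) (hj : IsNearest γ y' j) : (j - i).natAbs ≤ 2 * r + 1 := by
  have hK := hT.cover.connected
  refine hT.lift.natAbs_sub_le hT.shortest hT.cover hT.torsionFree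
    (by have := hT.lt_length; omega) ?_
  have h1 := hi.vdist_le hy
  have h2 := hj.vdist_le hy'
  have h3 := hK.vdist_triangle (K.src (γ i)) y (K.src (γ j))
  have h4 := hK.vdist_triangle y y' (K.src (γ j))
  rw [vdist_comm y' _] at h4
  omega

/-- The axis is only locally geodesic, so the hyperbolic estimate needs the drift to be at most L
beforehand. Induction along the chain provides this: one more step turns the bound B into at most B
+ 2r + 1 ≤ L, and the estimate for the whole chain restores B. -/
theorem natAbs_sub_le_of_short_chain (hT : HyperbolicTube p a g γ δ r d k B) {y : ℕ → K.V} {i : ℤ}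
    (hi : IsNearest γ (y 0) i) (m : ℕ) (hm : m ≤ 2 ^ k) (hy : ∀ l ≤ m, y l ∈ outerTube γ r d)
    (hyy : ∀ l < m, K.vdist (y l) (y (l + 1)) ≤ 1) {j : ℤ} (hj : IsNearest γ (y m) j) :
    (j - i).natAbs ≤ B := by
  have hK := hT.cover.connected
  have hE := hK.exists_src_eq (γ 0)
  have key : ∀ {m : ℕ} {j : ℤ}, m ≤ 2 ^ k → (∀ l ≤ m, y l ∈ outerTube γ r d) →
      (∀ l < m, K.vdist (y l) (y (l + 1)) ≤ 1) → IsNearest γ (y m) j →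
      (j - i).natAbs ≤ g.length → (j - i).natAbs ≤ B := by
    intro m j hm hy hyy hj hij
    have h1 := hT.hyperbolic.nearest_sub_le hT.nonneg hK hE hT.lift.joined
      (fun i k hk => hT.lift.vdist_nat hT.shortest hT.cover i hk) hi hj hij
      (d := d - 1 - k * δ) (by have := hT.lt_depth; linarith) fun n =>
      hT.hyperbolic.farFrom_of_chain hK hE k y m hm hyy fun l hl => by
        exact_mod_cast (hy l hl).2 n
    exact_mod_cast h1.trans hT.le_bound
  have hlen := hT.lt_length
  induction m generalizing j with
  | zero =>
    refine key hm hy hyy hj ?_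
    have := hT.natAbs_sub_le (hy 0 le_rfl).1 (hy 0 le_rfl).1 (by simp [vdist_self]) hi hj
    omega
  | succ m ih =>
    refine key hm hy hyy hj ?_
    obtain ⟨n, hn⟩ := exists_isNearest γ (y m)
    have h1 := ih (by omega) (fun l hl => hy l (by omega)) (fun l hl => hyy l (by omega)) hn
    have h2 := hT.natAbs_sub_le (hy m (by omega)).1 (hy (m + 1) le_rfl).1 (hyy m (by omega)) hn hj
    omega

/-- The chain is cut into at most q + 1 pieces of length at most 2^k, each contributing at most B.
-/
theorem natAbs_sub_le_of_chain (hT : HyperbolicTube p a g γ δ r d k B) (q : ℕ) :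
    ∀ {y : ℕ → K.V} {i : ℤ}, IsNearest γ (y 0) i → ∀ m ≤ (q + 1) * 2 ^ k,
    (∀ l ≤ m, y l ∈ outerTube γ r d) → (∀ l < m, K.vdist (y l) (y (l + 1)) ≤ 1) →
    ∀ {j : ℤ}, IsNearest γ (y m) j → (j - i).natAbs ≤ (q + 1) * B := by
  induction q with
  | zero =>
    intro y i hi m hm hy hyy j hj
    simpa using hT.natAbs_sub_le_of_short_chain hi m (by simpa using hm) hy hyy hj
  | succ q ih =>
    intro y i hi m hm hy hyy j hj
    rcases le_total m (2 ^ k) with h | h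
    · refine (hT.natAbs_sub_le_of_short_chain hi m h hy hyy hj).trans ?_
      exact Nat.le_mul_of_pos_left _ (by omega)
    · obtain ⟨n, hn⟩ := exists_isNearest γ (y (2 ^ k))
      have h1 := hT.natAbs_sub_le_of_short_chain hi (2 ^ k) le_rfl
        (fun l hl => hy l (hl.trans h)) (fun l hl => hyy l (hl.trans_le h)) hn
      have h2 := ih (y := fun l => y (2 ^ k + l)) hn (m - 2 ^ k)
        (by rw [Nat.sub_le_iff_le_add]; linarith) (fun l hl => hy _ (by omega))
        (fun l hl => hyy _ (by omega)) (j := j) (by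
          simpa only [Nat.add_sub_cancel' h] using hj)
      have h3 : (q + 1 + 1) * B = (q + 1) * B + B := by ring
      omega

end HyperbolicTube

/-- The values over which the infimum is taken in the definition of the potential. -/
def potentialValues (γ : ℤ → K.E) (r d : ℕ) (ε : ℝ) (x : K.V) : Set ℝ :=
  {s | ∃ (m : ℕ) (y : ℕ → K.V) (j : ℤ), y 0 = x ∧
    (∀ i < m, y i ∈ outerTube γ r d ∧ y (i + 1) ∈ outerTube γ r d ∧
      K.vdist (y i) (y (i + 1)) ≤ 1) ∧ IsNearest γ (y m) j ∧ s = j + ε * m}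

/-- A function on the tube which changes by at most `ε` along outer edges, at bounded distance of
the projection to the axis. -/
noncomputable def potential (γ : ℤ → K.E) (r d : ℕ) (ε : ℝ) (x : K.V) : ℝ :=
  sInf (potentialValues γ r d ε x)

theorem potentialValues_nonempty (ε : ℝ) (x : K.V) : (potentialValues γ r d ε x).Nonempty := by
  obtain ⟨j, hj⟩ := exists_isNearest γ x
  exact ⟨_, 0, fun _ => x, j, rfl, by simp, hj, rfl⟩

/-- A chain of m steps lowers the index by at most (m / 2^k + 1) B, and all but B of this is
compensated by the penalty m B / 2^k. -/
theorem HyperbolicTube.bddBelow_potentialValues (hT : HyperbolicTube p a g γ δ r d k B) {x : K.V}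
    (hx : x ∈ axisNbhd γ r) : BddBelow (potentialValues γ r d (B / 2 ^ k) x) := by
  obtain ⟨i, hi⟩ := exists_isNearest γ x
  refine ⟨i - B - (2 * r + 1), ?_⟩
  rintro _ ⟨m, y, j, rfl, hy, hj, rfl⟩
  have hpow : (0 : ℝ) < 2 ^ k := by positivity
  -- For m = 0 the vertex need not be outer; the index can still vary, among the nearest vertices of
  -- x, by at most 2r + 1.
  rcases Nat.eq_zero_or_pos m with rfl | hm
  · have h1 := hT.natAbs_sub_le hx hx (by simp [vdist_self]) hi hj
    have h2 : (i : ℝ) - (2 * r + 1) ≤ j := by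
      exact_mod_cast (by omega : (i : ℤ) - (2 * r + 1) ≤ j)
    have h3 : (0 : ℝ) ≤ B := Nat.cast_nonneg _
    simp only [Nat.cast_zero, mul_zero, add_zero]
    linarith
  · have h1 := hT.natAbs_sub_le_of_chain (m / 2 ^ k) hi m
      (Nat.lt_mul_of_div_lt (Nat.lt_succ_self _) (by positivity)).le (fun l hl => by
        rcases hl.lt_or_eq with h | rfl
        · exact (hy l h).1
        · have := (hy (l - 1) (by omega)).2.1
          rwa [Nat.sub_add_cancel hm] at this) (fun l hl => (hy l hl).2.2) hj
    have h2 : (i : ℝ) - (m / 2 ^ k + 1 : ℕ) * B ≤ j := by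
      have h3 : i - (((m / 2 ^ k + 1) * B : ℕ) : ℤ) ≤ j := by omega
      have h4 : ((i - (((m / 2 ^ k + 1) * B : ℕ) : ℤ) : ℤ) : ℝ) ≤ j := by exact_mod_cast h3
      rw [Int.cast_sub, Int.cast_natCast, Nat.cast_mul] at h4
      exact h4
    have h3 : ((m / 2 ^ k : ℕ) : ℝ) ≤ m / 2 ^ k := by
      have := Nat.cast_div_le (α := ℝ) (m := m) (n := 2 ^ k)
      simpa using this
    have h4 : ((m / 2 ^ k : ℕ) : ℝ) * B ≤ B / 2 ^ k * m := by
      refine (mul_le_mul_of_nonneg_right h3 (Nat.cast_nonneg _)).trans (le_of_eq ?_)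
      ring
    push_cast at h2
    have h5 : (0 : ℝ) ≤ r := Nat.cast_nonneg _
    nlinarith

/-- Prepending x to a competing chain for x' costs one step. -/
theorem HyperbolicTube.potential_le_add (hT : HyperbolicTube p a g γ δ r d k B) {x x' : K.V}
    (hx : x ∈ outerTube γ r d) (hx' : x' ∈ outerTube γ r d) (h : K.vdist x x' ≤ 1) :
    potential γ r d (B / 2 ^ k) x ≤ potential γ r d (B / 2 ^ k) x' + B / 2 ^ k := by
  rw [← sub_le_iff_le_add]
  refine le_csInf (potentialValues_nonempty _ _) ?_
  rintro _ ⟨m, y, j, rfl, hy, hj, rfl⟩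
  rw [sub_le_iff_le_add]
  refine csInf_le (hT.bddBelow_potentialValues hx.1)
    ⟨m + 1, fun i => Nat.casesOn i x y, j, rfl, fun i hi => ?_, hj, ?_⟩
  · cases i with
    | zero => exact ⟨hx, hx', h⟩
    | succ i => exact hy i (by omega)
  · push_cast
    ring

/-- A translation along the axis carries outer chains to outer chains and shifts nearest indices by
b. The inverse translation turns this inequality into equality. -/
theorem HyperbolicTube.potential_translate_le (hT : HyperbolicTube p a g γ δ r d k B) {h : deck p}
    {b : ℤ} (hb : ∀ n, h.1.2.1 (γ n) = γ (n + b)) {x : K.V} (hx : h.1.1 x ∈ axisNbhd γ r) :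
    potential γ r d (B / 2 ^ k) (h.1.1 x) ≤ potential γ r d (B / 2 ^ k) x + b := by
  have hK := hT.cover.connected
  have hv : ∀ y n, K.vdist (h.1.1 y) (K.src (γ n)) = K.vdist y (K.src (γ (n - b))) := fun y n => by
    rw [← hK.deck_vdist h y, ← deck_src, hb, sub_add_cancel]
  have hW : ∀ y ∈ outerTube γ r d, h.1.1 y ∈ outerTube γ r d := by
    rintro y ⟨h1, h2⟩
    obtain ⟨n, hn⟩ := mem_axisNbhd.1 h1
    refine ⟨mem_axisNbhd.2 ⟨n + b, ?_⟩, fun n => ?_⟩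
    · rwa [hv, add_sub_cancel_right]
    · rw [hv]
      exact h2 _
  rw [← sub_le_iff_le_add]
  refine le_csInf (potentialValues_nonempty _ _) ?_
  rintro _ ⟨m, y, j, rfl, hy, hj, rfl⟩
  rw [sub_le_iff_le_add]
  refine csInf_le (hT.bddBelow_potentialValues hx)
    ⟨m, fun i => h.1.1 (y i), j + b, rfl, fun i hi => ⟨hW _ (hy i hi).1, hW _ (hy i hi).2.1, ?_⟩,
      fun n => ?_, ?_⟩
  · rw [hK.deck_vdist]
    exact (hy i hi).2.2
  · rw [vdist_comm _ (h.1.1 _), vdist_comm _ (h.1.1 _), hv, hv, add_sub_cancel_right,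
      vdist_comm, vdist_comm (y m)]
    exact hj _
  · push_cast
    ring

theorem HyperbolicTube.potential_translate (hT : HyperbolicTube p a g γ δ r d k B) {h : deck p}
    {b : ℤ} (hb : ∀ n, h.1.2.1 (γ n) = γ (n + b)) {x : K.V} (hx : x ∈ axisNbhd γ r)
    (hhx : h.1.1 x ∈ axisNbhd γ r) :
    potential γ r d (B / 2 ^ k) (h.1.1 x) = potential γ r d (B / 2 ^ k) x + b := by
  refine le_antisymm (hT.potential_translate_le hb hhx) ?_
  have h1 := hT.potential_translate_le (h := h⁻¹) (b := -b) (x := h.1.1 x) (fun n => by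
    refine h.1.2.1.injective ?_
    rw [hb, neg_add_cancel_right]
    exact perm_apply_inv _ _) (by rwa [deck_inv_apply])
  rw [deck_inv_apply] at h1
  push_cast at h1
  linarith

/-- The change of the potential along an edge. -/
noncomputable def potentialDiff (γ : ℤ → K.E) (r d : ℕ) (ε : ℝ) (e : K.E) : ℝ :=
  potential γ r d ε (K.tgt e) - potential γ r d ε (K.src e)

theorem potentialDiff_rev (ε : ℝ) (e : K.E) :
    potentialDiff γ r d ε (K.rev e) = - potentialDiff γ r d ε e := by
  unfold potentialDiff
  rw [tgt_rev, neg_sub]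
  rfl

/-- Two lifts in the tube of one edge differ by a power of τ, which adds the same constant to the
potential at both ends. Hence the difference descends to M although the potential does not. -/
theorem HyperbolicTube.potentialDiff_eq (hT : HyperbolicTube p a g γ δ r d k B) {e e' : K.E}
    (he : e ∈ K.fullEdges (axisNbhd γ r)) (he' : e' ∈ K.fullEdges (axisNbhd γ r))
    (h : p.onE e = p.onE e') :
    potentialDiff γ r d (B / 2 ^ k) e = potentialDiff γ r d (B / 2 ^ k) e' := by
  obtain ⟨h, rfl⟩ := hT.cover.exists_deck_edge h
  obtain ⟨τ, hτ⟩ := hT.lift.exists_translation hT.cover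
  obtain ⟨h1, h2⟩ := he'
  rw [deck_src] at h1
  rw [deck_tgt] at h2
  obtain ⟨b, rfl⟩ := Subgroup.mem_zpowers_iff.1 (hT.lift.mem_zpowers hT.shortest hT.cover hτ
    (by have := hT.lt_length; omega) he.1 h1)
  have hb := translation_zpow hτ b
  unfold potentialDiff
  rw [deck_src, deck_tgt, hT.potential_translate hb he.1 h1, hT.potential_translate hb he.2 h2]
  ring

open Classical in
/-- The 1-cochain below given by the change of the potential along lifts in the tube. -/
noncomputable def tubeCochain (p : Hom K M) (γ : ℤ → K.E) (r d : ℕ) (ε : ℝ) (e : M.E) : ℝ :=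
  if h : ∃ e' ∈ K.fullEdges (axisNbhd γ r), p.onE e' = e then potentialDiff γ r d ε h.choose else 0

theorem HyperbolicTube.tubeCochain_onE (hT : HyperbolicTube p a g γ δ r d k B) {e : K.E}
    (he : e ∈ K.fullEdges (axisNbhd γ r)) :
    tubeCochain p γ r d (B / 2 ^ k) (p.onE e) = potentialDiff γ r d (B / 2 ^ k) e := by
  have h : ∃ e' ∈ K.fullEdges (axisNbhd γ r), p.onE e' = p.onE e := ⟨e, he, rfl⟩
  rw [tubeCochain, dif_pos h]
  exact hT.potentialDiff_eq h.choose_spec.1 he h.choose_spec.2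

theorem tubeCochain_of_not_mem {ε : ℝ} {e : M.E}
    (he : e ∉ p.onE '' K.fullEdges (axisNbhd γ r)) : tubeCochain p γ r d ε e = 0 := by
  rw [tubeCochain, dif_neg]
  exact he

theorem rev_mem_fullEdges {W : Set K.V} {e : K.E} (he : e ∈ K.fullEdges W) :
    K.rev e ∈ K.fullEdges W := ⟨he.2, by rw [tgt_rev]; exact he.1⟩

theorem HyperbolicTube.tubeCochain_rev (hT : HyperbolicTube p a g γ δ r d k B) (e : M.E) :
    tubeCochain p γ r d (B / 2 ^ k) (M.rev e) = - tubeCochain p γ r d (B / 2 ^ k) e := by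
  by_cases he : e ∈ p.onE '' K.fullEdges (axisNbhd γ r)
  · obtain ⟨e, he, rfl⟩ := he
    rw [p.rev_onE, hT.tubeCochain_onE he, hT.tubeCochain_onE (rev_mem_fullEdges he),
      potentialDiff_rev]
  · rw [tubeCochain_of_not_mem he, tubeCochain_of_not_mem, neg_zero]
    rintro ⟨e', he', h⟩
    refine he ⟨K.rev e', rev_mem_fullEdges he', ?_⟩
    rw [← p.rev_onE, h, M.rev_rev]

theorem HyperbolicTube.sum_tubeCochain (hT : HyperbolicTube p a g γ δ r d k B) {l : List K.E}
    {x y : K.V} (hl : K.IsPath l x y) (h : ∀ e ∈ l, e ∈ K.fullEdges (axisNbhd γ r)) :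
    ((l.map p.onE).map (tubeCochain p γ r d (B / 2 ^ k))).sum =
      potential γ r d (B / 2 ^ k) y - potential γ r d (B / 2 ^ k) x := by
  induction l generalizing x with
  | nil =>
    obtain rfl : x = y := hl
    simp
  | cons e l ih =>
    rw [List.map_cons, List.map_cons, List.sum_cons, ih hl.2 fun e he => h e (by simp [he]),
      hT.tubeCochain_onE (h e (by simp)), potentialDiff, hl.1]
    change _ - _ + (_ - potential γ r d (B / 2 ^ k) (K.tgt e)) = _
    ring

theorem mem_fullEdges_of_isPath {W : Set K.V} {l : List K.E} {x y : K.V} (hl : K.IsPath l x y)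
    (hy : y ∈ W) (h : ∀ e ∈ l, K.src e ∈ W) : ∀ e ∈ l, e ∈ K.fullEdges W := by
  induction l generalizing x with
  | nil => simp
  | cons e l ih =>
    have h2 := ih hl.2 fun e he => h e (by simp [he])
    intro e' he'
    rcases List.mem_cons.1 he' with rfl | h'
    · refine ⟨h _ (by simp), ?_⟩
      have h3 := hl.2
      cases l with
      | nil =>
        obtain rfl : K.tgt e' = y := h3
        exact hy
      | cons e l =>
        rw [show K.tgt e' = K.src e from h3.1.symm]
        exact h _ (by simp)
    · exact h2 _ h'

theorem bdry_isPath (f : K.F) : K.IsPath (K.bdry f) (K.base f) (K.base f) := K.isPath_bdry f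

/-- If a 2-cell with an edge in the tube has no lift in the tube, then the edge is outer. -/
theorem Connected.mem_outerTube (hK : K.Connected) {N : ℕ} {f : K.F} (hN : (K.bdry f).length ≤ N)
    (hd : d + 2 * N ≤ r) (hf : f ∉ K.fullFaces (axisNbhd γ r)) {e : K.E} (he : e ∈ K.bdry f)
    (heW : e ∈ K.fullEdges (axisNbhd γ r)) :
    K.src e ∈ outerTube γ r d ∧ K.tgt e ∈ outerTube γ r d := by
  -- Some vertex of the 2-cell is outside the tube, and any two of its vertices are at most 2N apart
  -- through the base.
  obtain ⟨w, hw, hw'⟩ : ∃ w, K.vdist (K.src e) w ≤ 2 * N ∧ w ∉ axisNbhd γ r := by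
    have h1 := (bdry_isPath f).vdist_src_le he
    rw [vdist_comm] at h1
    by_contra! h
    refine hf ⟨h _ (by omega), fun e' he' => h _ ?_⟩
    have h2 := (bdry_isPath f).vdist_src_le he'
    have h3 := hK.vdist_triangle (K.src e) (K.base f) (K.src e')
    omega
  have hfar : ∀ n, r < K.vdist w (K.src (γ n)) := fun n => by
    by_contra! h
    exact hw' (mem_axisNbhd.2 ⟨n, h⟩)
  refine ⟨⟨heW.1, fun n => ?_⟩, ⟨heW.2, fun n => ?_⟩⟩
  · have h1 := hK.vdist_triangle w (K.src e) (K.src (γ n))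
    rw [vdist_comm w (K.src e)] at h1
    have := hfar n
    omega
  -- The strict inequality in `hfar` pays for the additional edge from source to target.
  · have h1 := hK.vdist_triangle w (K.src e) (K.src (γ n))
    have h2 := hK.vdist_triangle (K.src e) (K.tgt e) (K.src (γ n))
    have h3 := vdist_src_tgt e
    rw [vdist_comm w (K.src e)] at h1
    have := hfar n
    omega

theorem abs_sum_map_le {α : Type u} (θ : α → ℝ) {b : ℝ} (l : List α) (h : ∀ e ∈ l, |θ e| ≤ b) :
    |(l.map θ).sum| ≤ l.length * b := by
  induction l with
  | nil => simp
  | cons e l ih =>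
    rw [List.map_cons, List.sum_cons, List.length_cons]
    refine (abs_add_le _ _).trans ?_
    have h1 := ih fun e he => h e (by simp [he])
    have h2 := h e (by simp)
    push_cast
    linarith

/-- If some lift lies in the tube, the sum telescopes around a closed path. Otherwise each boundary
edge is either outside the image of the tube, with value 0, or outer, with value at most ε. -/
theorem HyperbolicTube.abs_sum_bdry_le (hT : HyperbolicTube p a g γ δ r d k B) {N : ℕ}
    (hN : ∀ f : K.F, (K.bdry f).length ≤ N) (hd : d + 2 * N ≤ r) (f : M.F) :
    |((M.bdry f).map (tubeCochain p γ r d (B / 2 ^ k))).sum| ≤ N * (B / 2 ^ k) := by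
  have hK := hT.cover.connected
  have hε : (0 : ℝ) ≤ B / 2 ^ k := by positivity
  by_cases hf : ∃ f' ∈ K.fullFaces (axisNbhd γ r), p.onF f' = f
  · obtain ⟨f, hf, rfl⟩ := hf
    rw [p.bdry_onF, hT.sum_tubeCochain (K.isPath_bdry f)
      (mem_fullEdges_of_isPath (K.isPath_bdry f) hf.1 hf.2), sub_self, abs_zero]
    positivity
  · have hlen : (M.bdry f).length ≤ N := by
      obtain ⟨f, rfl⟩ := hT.cover.exists_face_over f
      rw [p.bdry_onF, List.length_map]
      exact hN f
    refine (abs_sum_map_le _ (b := B / 2 ^ k) _ fun e he => ?_).trans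
      (mul_le_mul_of_nonneg_right (by exact_mod_cast hlen) hε)
    by_cases heW : e ∈ p.onE '' K.fullEdges (axisNbhd γ r)
    · obtain ⟨e, heW, rfl⟩ := heW
      obtain ⟨f', rfl, he'⟩ := hT.cover.exists_face_through he
      obtain ⟨h1, h2⟩ := hK.mem_outerTube (hN f') hd (fun h => hf ⟨f', h, rfl⟩) he' heW
      have h3 := vdist_src_tgt e
      have h4 := hT.potential_le_add h1 h2 h3
      rw [vdist_comm] at h3
      have h5 := hT.potential_le_add h2 h1 h3
      rw [hT.tubeCochain_onE heW, potentialDiff, abs_le]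
      constructor <;> linarith
    · rw [tubeCochain_of_not_mem heW, abs_zero]
      exact hε

/-- One period of the axis ends at the τ-translate of its start, where the potential is larger by L.
-/
theorem HyperbolicTube.sum_tubeCochain_loop (hT : HyperbolicTube p a g γ δ r d k B) :
    (g.map (tubeCochain p γ r d (B / 2 ^ k))).sum = g.length := by
  have hmem : ∀ n, K.src (γ n) ∈ axisNbhd γ r := fun n =>
    mem_axisNbhd.2 ⟨n, by simp [vdist_self]⟩
  have h := hT.sum_tubeCochain (isPath_of_joined hT.lift.joined 0 g.length) (by
    intro e he
    obtain ⟨j, -, rfl⟩ := List.mem_map.1 he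
    exact ⟨hmem _, by rw [hT.lift.joined]; exact hmem _⟩)
  rw [hT.lift.map_segment] at h
  rw [h]
  obtain ⟨τ, hτ⟩ := hT.lift.exists_translation hT.cover
  have h1 := hT.potential_translate (b := g.length) hτ (hmem 0) (by
    rw [← deck_src, hτ]; exact hmem _)
  rw [← deck_src, hτ] at h1
  rw [h1]
  push_cast
  ring

end Potential

/-! ### Lower bounds for fillings -/

section Fillings

variable {K M : TwoComplex.{u}} {p : Hom K M} {a : M.V} {g : List M.E} {γ : ℤ → K.E} {δ : ℝ}
  {r d k B : ℕ}

/-- Evaluation of integral 1-chains on a function on oriented edges. -/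
noncomputable def pairing (θ : K.E → ℝ) : K.OneChain ℤ →+ ℝ where
  toFun c := (c : K.E →₀ ℤ).sum fun e n => (n : ℝ) * θ e
  map_zero' := by simp
  map_add' c c' := by
    rw [Submodule.coe_add]
    exact Finsupp.sum_add_index' (by simp) (by intros; push_cast; ring)

/-- The coefficient of an integral 1-chain at an oriented edge. -/
noncomputable def coefficient (e : K.E) : K.OneChain ℤ →+ ℝ where
  toFun c := ((c : K.E →₀ ℤ) e : ℝ)
  map_zero' := by simp
  map_add' c c' := by simp

theorem pairing_edgeChain (θ : K.E → ℝ) (e : K.E) :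
    pairing θ (K.edgeChain ℤ e) = θ e - θ (K.rev e) := by
  change ((Finsupp.single e (1 : ℤ) - Finsupp.single (K.rev e) 1).sum fun e n => (n : ℝ) * θ e) = _
  rw [Finsupp.sum_sub_index (by intros; push_cast; ring), Finsupp.sum_single_index (by simp),
    Finsupp.sum_single_index (by simp)]
  simp

theorem map_pathChain (F : K.OneChain ℤ →+ ℝ) (l : List K.E) :
    F (K.pathChain ℤ l) = (l.map fun e => F (K.edgeChain ℤ e)).sum := by
  rw [pathChain, map_list_sum, List.map_map]
  rfl

/-- The factor 2 appears because both orientations of each geometric edge enter the pairing. -/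
theorem pairing_pathChain {θ : K.E → ℝ} (hθ : ∀ e, θ (K.rev e) = - θ e) (l : List K.E) :
    pairing θ (K.pathChain ℤ l) = 2 * (l.map θ).sum := by
  rw [map_pathChain, ← List.sum_map_mul_left]
  congr 1
  refine List.map_congr_left fun e _ => ?_
  rw [pairing_edgeChain, hθ]
  ring

theorem pairing_eq_zero {θ : K.E → ℝ} {c : K.OneChain ℤ} (h : ∀ e, c.1 e ≠ 0 → θ e = 0) :
    pairing θ c = 0 :=
  Finset.sum_eq_zero fun e he => by simp [h e (Finsupp.mem_support_iff.1 he)]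

theorem abs_map_bd₂_le (F : K.OneChain ℤ →+ ℝ) {κ : ℝ}
    (h : ∀ f, |F (K.pathChain ℤ (K.bdry f))| ≤ κ) (A : K.TwoChain ℤ) :
    |F (K.bd₂ ℤ A)| ≤ κ * K.norm₂ A := by
  rw [bd₂, Finsupp.linearCombination_apply, map_finsuppSum, norm₂, Finsupp.sum, Finsupp.sum,
    Nat.cast_sum, Finset.mul_sum]
  refine (Finset.abs_sum_le_sum_abs _ _).trans (Finset.sum_le_sum fun f _ => ?_)
  rw [map_zsmul, zsmul_eq_mul, abs_mul, mul_comm, Nat.cast_natAbs, Int.cast_abs]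
  exact mul_le_mul_of_nonneg_right (h f) (abs_nonneg _)

theorem coefficient_edgeChain [DecidableEq K.E] (e e' : K.E) :
    coefficient e (K.edgeChain ℤ e') =
      (if e' = e then 1 else 0) - (if K.rev e' = e then 1 else 0) := by
  change (((Finsupp.single e' 1 - Finsupp.single (K.rev e') 1 : K.E →₀ ℤ) e : ℤ) : ℝ) = _
  rw [Finsupp.sub_apply, Finsupp.single_apply, Finsupp.single_apply]
  push_cast
  rfl

theorem abs_coefficient_pathChain_le (e : K.E) (l : List K.E) :
    |coefficient e (K.pathChain ℤ l)| ≤ l.length := by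
  classical
  rw [map_pathChain, ← mul_one (l.length : ℝ)]
  refine abs_sum_map_le _ l fun e' _ => ?_
  rw [coefficient_edgeChain, abs_le]
  split_ifs <;> norm_num

/-- A shortest essential loop passes only once through its first edge. -/
theorem IsLift.coefficient_pathChain (hγ : IsLift p g γ) (hg : M.IsShortestEssential a g)
    (hp : p.IsUniversalCover) : coefficient (p.onE (γ 0)) (M.pathChain ℤ g) = 1 := by
  classical
  have hK := hp.connected
  have hL := hg.length_pos
  have hdisp : ∀ (h : deck p) (i j : ℤ), h.1.1 (K.src (γ i)) = K.src (γ j) →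
      (j - i).natAbs < g.length → h = 1 := by
    intro h i j hij hlt
    by_contra hne
    have h1 := hg.le_displacement hp hne (K.src (γ i))
    rw [hij, hγ.vdist_int hg hp hlt.le] at h1
    omega
  have hinj : ∀ i j : ℤ, K.src (γ i) = K.src (γ j) → (j - i).natAbs ≤ g.length → i = j := by
    intro i j hij hle
    have h1 := hγ.vdist_int hg hp hle
    rw [hij, vdist_self] at h1
    omega
  have h1 : ∀ i : ℕ, i < g.length → p.onE (γ i) = p.onE (γ 0) → i = 0 := by
    intro i hi h
    obtain ⟨h, hh⟩ := hp.exists_deck_edge h.symm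
    have h2 : h.1.1 (K.src (γ 0)) = K.src (γ i) := by rw [← deck_src, hh]
    obtain rfl := hdisp h 0 i h2 (by omega)
    have := hinj 0 i h2 (by omega)
    omega
  have h2 : ∀ i : ℕ, i < g.length → M.rev (p.onE (γ i)) ≠ p.onE (γ 0) := by
    intro i hi h
    rw [p.rev_onE] at h
    obtain ⟨σ, hh⟩ := hp.exists_deck_edge h.symm
    have h3 : σ.1.1 (K.src (γ 0)) = K.src (γ (i + 1)) := by
      rw [← deck_src, hh, ← hγ.joined]
      rfl
    have h4 : σ.1.1 (K.src (γ 1)) = K.src (γ i) := by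
      have := hγ.joined 0
      rw [zero_add] at this
      rw [← this, ← deck_tgt, hh, tgt_rev]
    -- For i = 0 the displacement bound is useless when L = 1, but the edge would be its own
    -- reverse. For i > 0, σ moves `K.src (γ 1)` by i - 1 < L, so it is trivial and the axis would
    -- fold back.
    rcases Nat.eq_zero_or_pos i with rfl | hi0
    · have h5 := deck_onE σ (γ 0)
      rw [hh, ← p.rev_onE] at h5
      exact M.rev_ne _ h5
    · obtain rfl := hdisp σ 1 i h4 (by omega)
      have h5 := hinj 1 i h4 (by omega)
      have h6 := hinj 0 (i + 1) h3 (by omega)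
      omega
  have h3 : coefficient (p.onE (γ 0)) (M.pathChain ℤ g) =
      ∑ i ∈ Finset.range g.length, coefficient (p.onE (γ 0)) (M.edgeChain ℤ (p.onE (γ i))) := by
    conv_lhs => rw [← hγ.map_segment]
    rw [map_pathChain, List.map_map, List.map_map]
    simp only [zero_add]
    rfl
  rw [h3, Finset.sum_eq_single_of_mem 0 (by simpa using hL)]
  · rw [coefficient_edgeChain, if_pos (by simp), if_neg (h2 0 hL), sub_zero]
  · intro i hi hi0
    rw [Finset.mem_range] at hi
    rw [coefficient_edgeChain, if_neg fun h => hi0 (h1 i hi h), if_neg (h2 i hi), sub_zero]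

theorem Hom.IsUniversalCover.bdry_length_le (hp : p.IsUniversalCover) {N : ℕ}
    (hN : ∀ f : K.F, (K.bdry f).length ≤ N) (f : M.F) : (M.bdry f).length ≤ N := by
  obtain ⟨f, rfl⟩ := hp.exists_face_over f
  rw [p.bdry_onF, List.length_map]
  exact hN f

theorem IsLift.onE_zero_mem (hγ : IsLift p g γ) :
    p.onE (γ 0) ∈ g := by
  have h := hγ.covers 0
  rw [Int.zero_emod] at h
  exact List.mem_of_getElem? h

/-- At the first edge of g the boundary has coefficient m, and each 2-cell contributes at most N
there. This settles small R. -/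
theorem IsLift.abs_le_norm₂ (hγ : IsLift p g γ) (hg : M.IsShortestEssential a g)
    (hp : p.IsUniversalCover) {N : ℕ} (hN : ∀ f : K.F, (K.bdry f).length ≤ N)
    {A : M.TwoChain ℤ} {m : ℤ} {c : M.OneChain ℤ} (hA : M.bd₂ ℤ A = m • M.pathChain ℤ g + c)
    (hc : ∀ e ∈ g, c.1 e = 0) : |(m : ℝ)| ≤ N * M.norm₂ A := by
  have h := abs_map_bd₂_le (coefficient (p.onE (γ 0))) (κ := N) (fun f =>
    (abs_coefficient_pathChain_le _ _).trans (by exact_mod_cast hp.bdry_length_le hN f)) A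
  have h0 : coefficient (p.onE (γ 0)) c = 0 := by
    change ((c.1 (p.onE (γ 0)) : ℤ) : ℝ) = 0
    rw [hc _ (hγ.onE_zero_mem), Int.cast_zero]
  rw [hA, map_add, map_zsmul, hγ.coefficient_pathChain hg hp, h0, add_zero, zsmul_eq_mul,
    mul_one] at h
  exact h

/-- Evaluate the tube cochain on both sides of `hA`: it is L on g, zero on c, and at most N B / 2^k
on each attaching path. -/
theorem HyperbolicTube.abs_mul_length_le (hT : HyperbolicTube p a g γ δ r d k B) {N : ℕ}
    (hN : ∀ f : K.F, (K.bdry f).length ≤ N) (hd : d + 2 * N ≤ r)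
    {A : M.TwoChain ℤ} {m : ℤ} {c : M.OneChain ℤ} (hA : M.bd₂ ℤ A = m • M.pathChain ℤ g + c)
    (hc : ∀ e, c.1 e ≠ 0 → e ∉ p.onE '' K.fullEdges (axisNbhd γ r)) :
    |(m : ℝ)| * g.length ≤ N * (B / 2 ^ k) * M.norm₂ A := by
  have h := abs_map_bd₂_le (pairing (tubeCochain p γ r d (B / 2 ^ k)))
    (κ := 2 * (N * (B / 2 ^ k))) (fun f => by
      rw [pairing_pathChain hT.tubeCochain_rev, abs_mul, abs_two]
      exact mul_le_mul_of_nonneg_left (hT.abs_sum_bdry_le hN hd f) zero_le_two) A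
  rw [hA, map_add, map_zsmul, pairing_pathChain hT.tubeCochain_rev, hT.sum_tubeCochain_loop,
    pairing_eq_zero fun e he => tubeCochain_of_not_mem (hc e he), add_zero, zsmul_eq_mul, abs_mul,
    abs_mul, abs_two, Nat.abs_cast] at h
  linarith

/-- Edges of the frontier of the tube of radius `⌊(L - 1) / 4⌋` do not lie in smaller tubes. -/
theorem Hom.IsUniversalCover.not_mem_of_mem_tubeFrontier (hp : p.IsUniversalCover) {N : ℕ}
    (hN : ∀ f : K.F, (K.bdry f).length ≤ N) (hr : r + 2 * N ≤ (g.length - 1) / 4) {e : M.E}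
    (he : e ∈ tubeFrontier p g γ) : e ∉ p.onE '' K.fullEdges (axisNbhd γ r) := by
  have hK := hp.connected
  rintro ⟨e, heW, rfl⟩
  obtain ⟨-, f, hf, hef⟩ := he
  obtain ⟨f, e', he', rfl, he'f⟩ : ∃ (f' : K.F) (e' : K.E), e' ∈ K.fullEdges (axisNbhd γ r) ∧
      p.onF f' = f ∧ e' ∈ K.bdry f' := by
    rcases hef with h | h
    · obtain ⟨f', h1, h2⟩ := hp.exists_face_through h
      exact ⟨f', e, heW, h1, h2⟩
    · rw [p.rev_onE] at h
      obtain ⟨f', h1, h2⟩ := hp.exists_face_through h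
      exact ⟨f', _, rev_mem_fullEdges heW, h1, h2⟩
  obtain ⟨n, hn⟩ := mem_axisNbhd.1 he'.1
  -- The base of the lifted 2-cell is within r + N of the axis, so the whole cell lies within r + 2N
  -- and would belong to the tube.
  have hW : ∀ w, K.vdist (K.base f) w ≤ N → w ∈ tubeV g γ := by
    intro w hw
    refine mem_axisNbhd.2 ⟨n, ?_⟩
    have h1 := (bdry_isPath f).vdist_src_le he'f
    have h2 := hN f
    have h3 := hK.vdist_triangle w (K.base f) (K.src (γ n))
    have h4 := hK.vdist_triangle (K.base f) (K.src e') (K.src (γ n))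
    rw [vdist_comm w (K.base f)] at h3
    omega
  refine hf ⟨f, ⟨hW _ (by simp [vdist_self]), fun e he => hW _ ?_⟩, rfl⟩
  exact ((bdry_isPath f).vdist_src_le he).trans (hN f)

theorem Hom.exists_bdry_length_le (p : Hom K M) (hM : M.IsFinite) :
    ∃ N : ℕ, ∀ f : K.F, (K.bdry f).length ≤ N := by
  have := hM.2.2
  obtain ⟨N, hN⟩ := (Set.finite_range fun f => (M.bdry f).length).bddAbove
  refine ⟨N, fun f => ?_⟩
  have h := hN ⟨p.onF f, rfl⟩
  change (M.bdry (p.onF f)).length ≤ N at h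
  rwa [p.bdry_onF, List.length_map] at h

/-- Fillings of chains which are multiples of a shortest essential loop inside of the tube around
it are exponentially large. -/
theorem exists_filling_constants (X : TwoComplex.{u}) {δ : ℝ} (hδ : 0 < δ)
    (hX : X.IsHyperbolic δ) : ∃ C R₀ : ℝ, 0 < C ∧
      ∀ (M : TwoComplex.{u}) (p : Hom X M), M.IsFinite → p.IsUniversalCover → M.TorsionFreePi1 →
        ∀ (a : M.V) (g : List M.E), M.IsShortestEssential a g →
          ∀ (γ : ℤ → X.E), IsLift p g γ →
            ∀ (A : M.TwoChain ℤ) (m : ℤ) (c : M.OneChain ℤ),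
              (∀ e, c.1 e ≠ 0 → e ∈ tubeFrontier p g γ) →
              (R₀ ≤ ((g.length - 1) / 4 : ℕ) ∨ ∀ e ∈ g, c.1 e = 0) →
              M.bd₂ ℤ A = m • M.pathChain ℤ g + c →
              |(m : ℝ)| * 2 ^ (((((g.length - 1) / 4 : ℕ) : ℝ) - R₀ - 1) / δ) ≤
                C * M.norm₂ A := by
  by_cases hN : ∃ N : ℕ, ∀ f : X.F, (X.bdry f).length ≤ N
  swap
  -- With attaching paths of unbounded length, X covers no finite complex.
  · exact ⟨1, 0, one_pos, fun M p hM => absurd (p.exists_bdry_length_le hM) hN⟩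
  obtain ⟨N, hN⟩ := hN
  set B : ℕ := ⌈8 * δ + 1⌉₊ with hB
  -- The tube of radius R - s satisfies `lt_length`, and as s ≥ 2N it avoids the frontier. A further
  -- 2N in R₀ separates d from the radius, and 2δ + 2 makes d - 1 exceed 2δ.
  set s : ℕ := B + 2 * N + 1 with hs
  -- The summand 8NB serves large R, N serves small R, and 1 ensures positivity.
  refine ⟨8 * N * B + N + 1, s + 2 * N + (2 * δ + 2), by positivity, ?_⟩
  intro M p hM hp htf a g hg γ hγ A m c hc hcg hA
  set R := (g.length - 1) / 4 with hR
  have hA0 : (0 : ℝ) ≤ M.norm₂ A := Nat.cast_nonneg _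
  rcases lt_or_ge (R : ℝ) (s + 2 * N + (2 * δ + 2)) with hlt | hle
  · have h1 := hγ.abs_le_norm₂ hg hp hN hA (hcg.resolve_left hlt.not_ge)
    have h2 : (2 : ℝ) ^ (((R : ℝ) - (s + 2 * N + (2 * δ + 2)) - 1) / δ) ≤ 1 :=
      Real.rpow_le_one_of_one_le_of_nonpos one_le_two
        (div_nonpos_of_nonpos_of_nonneg (by linarith) hδ.le)
    refine (mul_le_of_le_one_right (abs_nonneg _) h2).trans (h1.trans ?_)
    refine mul_le_mul_of_nonneg_right ?_ hA0
    have : (0 : ℝ) ≤ 8 * N * B := by positivity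
    linarith
  · have hRs : s + 2 * N ≤ R := by
      have : ((s + 2 * N : ℕ) : ℝ) ≤ R := by push_cast; linarith
      exact_mod_cast this
    set d := R - s - 2 * N with hd
    have hdR : (d : ℝ) = R - s - 2 * N := by
      rw [hd, Nat.cast_sub (by omega), Nat.cast_sub (by omega)]
      push_cast
      ring
    -- Subtracting 3 makes k + 2 strictly less than (d - 1) / δ, as `lt_depth` requires; the loss is
    -- the factor 8 in C.
    set k := ⌈((d : ℝ) - 1) / δ⌉₊ - 3 with hk
    have hq : 2 < ((d : ℝ) - 1) / δ := by
      rw [lt_div_iff₀ hδ]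
      linarith
    have hk3 : 3 ≤ ⌈((d : ℝ) - 1) / δ⌉₊ := by
      have : 2 < ⌈((d : ℝ) - 1) / δ⌉₊ := Nat.lt_ceil.2 (by exact_mod_cast hq)
      omega
    have hkR : (k : ℝ) = ⌈((d : ℝ) - 1) / δ⌉₊ - 3 := by
      rw [hk, Nat.cast_sub hk3]
      norm_num
    have hT : HyperbolicTube p a g γ δ (R - s) d k B := by
      refine ⟨hp, htf, hg, hγ, hX, hδ.le, Nat.le_ceil _, by omega, ?_⟩
      have h1 : (k : ℝ) < ((d : ℝ) - 1) / δ - 2 := by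
        have := Nat.ceil_lt_add_one (a := ((d : ℝ) - 1) / δ) (by linarith)
        linarith
      have h2 : (k + 2) * δ < (d : ℝ) - 1 := by
        rw [← lt_div_iff₀ hδ]
        linarith
      linarith
    have h1 := hT.abs_mul_length_le hN (by omega) hA fun e he =>
      hp.not_mem_of_mem_tubeFrontier hN (by omega) (hc e he)
    have hL : (1 : ℝ) ≤ g.length := by exact_mod_cast hg.length_pos
    have h2 : |(m : ℝ)| * 2 ^ k ≤ N * B * M.norm₂ A := by
      have h3 : |(m : ℝ)| ≤ N * (B / 2 ^ k) * M.norm₂ A :=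
        (le_mul_of_one_le_right (abs_nonneg _) hL).trans h1
      calc |(m : ℝ)| * 2 ^ k ≤ N * (B / 2 ^ k) * M.norm₂ A * 2 ^ k :=
            mul_le_mul_of_nonneg_right h3 (by positivity)
        _ = N * B * M.norm₂ A := by field_simp
    have h4 : (2 : ℝ) ^ (((R : ℝ) - (s + 2 * N + (2 * δ + 2)) - 1) / δ) ≤ 8 * 2 ^ k := by
      have h5 : (8 : ℝ) * 2 ^ k = 2 ^ ((k : ℝ) + 3) := by
        rw [Real.rpow_add two_pos, Real.rpow_natCast]
        norm_num
        ring
      rw [h5]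
      refine Real.rpow_le_rpow_of_exponent_le one_le_two ?_
      rw [hkR, sub_add_cancel]
      refine le_trans ?_ (Nat.le_ceil _)
      exact div_le_div_of_nonneg_right (by linarith) hδ.le
    have h6 : (0 : ℝ) ≤ (N + 1) * M.norm₂ A := by positivity
    nlinarith [mul_le_mul_of_nonneg_left h4 (abs_nonneg (m : ℝ))]

end Fillings

/-! ### Quotients of a universal covering -/

section Quotients

variable {K M : TwoComplex.{u}} {p : Hom K M}

/-- The projection of a covering complex to its quotient by a group of deck transformations. -/
def quotHom (H : Subgroup (deck p)) : Hom K (quot H) where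
  onV := Quotient.mk (orbV H)
  onE := Quotient.mk (orbE H)
  onF := Quotient.mk (orbF H)
  src_onE _ := rfl
  rev_onE _ := rfl
  base_onF _ := rfl
  bdry_onF _ := rfl

/-- The map to the base induced on a quotient of a covering complex. -/
def quotDown (H : Subgroup (deck p)) : Hom (quot H) M where
  onV := Quotient.lift p.onV (by
    rintro x y ⟨h, -, rfl⟩
    exact (deck_onV h x).symm)
  onE := Quotient.lift p.onE (by
    rintro x y ⟨h, -, rfl⟩
    exact (deck_onE h x).symm)
  onF := Quotient.lift p.onF (by
    rintro x y ⟨h, -, rfl⟩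
    exact (deck_onF h x).symm)
  src_onE := by
    rintro ⟨e⟩
    exact p.src_onE e
  rev_onE := by
    rintro ⟨e⟩
    exact p.rev_onE e
  base_onF := by
    rintro ⟨f⟩
    exact p.base_onF f
  bdry_onF := by
    rintro ⟨f⟩
    refine (p.bdry_onF f).trans ?_
    change _ = List.map _ (List.map (Quotient.mk (orbE H)) (K.bdry f))
    rw [List.map_map]
    rfl

theorem Hom.IsUniversalCover.quotHom (hp : p.IsUniversalCover) (H : Subgroup (deck p)) :
    (quotHom H).IsUniversalCover := by
  refine ⟨⟨Quotient.exists_rep, ?_, ?_⟩, hp.2⟩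
  · rintro x ⟨e⟩ he
    obtain ⟨h, hh, rfl⟩ := Quotient.exact he
    refine ⟨h.1.2.1 e, ⟨deck_src h e, (Quotient.sound (s := orbE H) (a := e) ⟨h, hh, rfl⟩).symm⟩, ?_⟩
    rintro e' ⟨h1, h2⟩
    obtain ⟨k, -, hk⟩ := Quotient.exact h2
    refine hp.1.edge_unique (h1.trans (deck_src h e).symm) ?_
    rw [deck_onE, ← hk, deck_onE]
  · rintro x ⟨f⟩ hf
    obtain ⟨h, hh, rfl⟩ := Quotient.exact hf
    refine ⟨h.1.2.2 f, ⟨h.2.2.2.1 f, (Quotient.sound (s := orbF H) (a := f) ⟨h, hh, rfl⟩).symm⟩, ?_⟩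
    rintro f' ⟨h1, h2⟩
    obtain ⟨k, -, hk⟩ := Quotient.exact h2
    refine hp.1.face_unique (h1.trans (h.2.2.2.1 f).symm) ?_
    rw [deck_onF, ← hk, deck_onF]

theorem endsAt_quotDown {H : Subgroup (deck p)} {x y : K.V} {l : List (quot H).E}
    (h : (quotHom H).EndsAt x l y) : p.EndsAt x (l.map (quotDown H).onE) y := by
  obtain ⟨m, hm, rfl⟩ := h
  exact ⟨m, hm, by rw [List.map_map]; rfl⟩

/-- A loop of the quotient with a null-homotopic power is null-homotopic after projection to M, so
its lift to K closes up. -/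
theorem Hom.IsUniversalCover.torsionFreePi1_quot (hp : p.IsUniversalCover) (hM : M.TorsionFreePi1)
    (H : Subgroup (deck p)) : (quot H).TorsionFreePi1 := by
  have hq := hp.quotHom H
  intro a l n hl hn hnull
  obtain ⟨x, rfl⟩ := hq.1.surj a
  rw [hq.nullHomotopic_iff] at hnull ⊢
  have h1 := endsAt_quotDown hnull
  rw [List.map_flatten, List.map_replicate, ← hp.nullHomotopic_iff] at h1
  have h2 := hM _ _ n ((quotDown H).map_isPath hl) hn h1
  obtain ⟨y, hy, -⟩ := hq.1.exists_endsAt hl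
  have h3 := hp.1.endsAt_unique (endsAt_quotDown hy) (hp.nullHomotopic_iff.1 h2)
  rwa [h3] at hy

/-- Up to the action of N, a point is determined by its fibre over β and a coset of N. -/
theorem finite_quotient_of_finiteIndex {G α β : Type u} [Group G] [Finite β] {N : Subgroup G}
    (hN : N.Normal) (hN' : N.FiniteIndex) (act : G → α → α)
    (hmul : ∀ h k x, act (h * k) x = act h (act k x)) {π : α → β}
    (htrans : ∀ x y, π x = π y → ∃ h, act h x = y) (s : Setoid α)
    (hs : ∀ h ∈ N, ∀ x, s x (act h x)) : Finite (Quotient s) := by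
  let f : Set.range π × (G ⧸ N) → Quotient s := fun bq => ⟦act bq.2.out bq.1.2.choose⟧
  refine Finite.of_surjective f ?_
  rintro ⟨x⟩
  have hx : ∃ y, π y = π x := ⟨x, rfl⟩
  obtain ⟨h, hh⟩ := htrans hx.choose x hx.choose_spec
  obtain ⟨n, hn⟩ := QuotientGroup.mk_out_eq_mul N h
  refine ⟨⟨⟨π x, x, rfl⟩, (h : G ⧸ N)⟩, (Quotient.sound ?_).symm⟩
  change s x (act (h : G ⧸ N).out hx.choose)
  -- Normality moves the error n of the coset representative to the left, where it acts within an
  -- orbit.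
  rw [hn, show h * n = (h * n * h⁻¹) * h by group, hmul, hh]
  exact hs _ (hN.conj_mem _ n.2 _) x

theorem Hom.IsUniversalCover.isFinite_quot (hp : p.IsUniversalCover) (hM : M.IsFinite)
    {N : Subgroup (deck p)} (hN : N.Normal) (hN' : N.FiniteIndex) : (quot N).IsFinite := by
  obtain ⟨_, _, _⟩ := hM
  refine ⟨?_, ?_, ?_⟩
  · exact finite_quotient_of_finiteIndex hN hN' (fun h x => h.1.1 x) (fun _ _ _ => rfl)
      (fun x y h => hp.exists_deck h) (orbV N) fun h hh x => ⟨h, hh, rfl⟩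
  · exact finite_quotient_of_finiteIndex hN hN' (fun h x => h.1.2.1 x) (fun _ _ _ => rfl)
      (fun x y h => hp.exists_deck_edge h) (orbE N) fun h hh x => ⟨h, hh, rfl⟩
  · exact finite_quotient_of_finiteIndex hN hN' (fun h x => h.1.2.2 x) (fun _ _ _ => rfl)
      (fun x y h => hp.exists_deck_face h) (orbF N) fun h hh x => ⟨h, hh, rfl⟩

/-- The transformation is determined by the image of x, hence by the projection to M of a shortest
path to it; M has finitely many edge lists of length at most n. -/
theorem Hom.IsUniversalCover.finite_displacement_le (hp : p.IsUniversalCover) (hM : M.IsFinite)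
    (x : K.V) (n : ℕ) : {h : deck p | K.vdist x (h.1.1 x) ≤ n}.Finite := by
  have := hM.2.1
  choose l hl hl' using fun h : deck p => hp.connected.exists_path x (h.1.1 x)
  refine Set.Finite.of_injOn (f := fun h => (l h).map p.onE) (t := {m | m.length ≤ n}) ?_ ?_
    (List.finite_length_le M.E n)
  · intro h hh
    rw [Set.mem_ofPred_eq, List.length_map, hl']
    exact hh
  · intro h _ k _ hhk
    refine hp.deck_eq (x := x) (hp.1.endsAt_unique ⟨_, hl h, rfl⟩ ⟨_, hl k, hhk.symm⟩)

/-- The lengths of essential loops tend to infinity along residual chains. -/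
theorem Hom.IsUniversalCover.eventually_lt_length (hp : p.IsUniversalCover) (hM : M.IsFinite)
    {N : ℕ → Subgroup (deck p)} (hN : IsResidualChain N) (n : ℕ) :
    ∀ᶠ i in atTop, ∀ (a : (quot (N i)).V) (g : List (quot (N i)).E), (quot (N i)).IsPath g a a →
      ¬ (quot (N i)).NullHomotopic a g → n < g.length := by
  have := hM.1
  choose σ hσ using hp.1.surj
  have hfin : (⋃ v, {h : deck p | K.vdist (σ v) (h.1.1 (σ v)) ≤ n}).Finite :=
    Set.finite_iUnion fun v => hp.finite_displacement_le hM (σ v) n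
  have hev : ∀ᶠ i in atTop, ∀ h ∈ ⋃ v, {h : deck p | K.vdist (σ v) (h.1.1 (σ v)) ≤ n},
      h ∈ N i → h = 1 := by
    refine (eventually_all_finite hfin).2 fun h _ => ?_
    by_cases h1 : h = 1
    · exact Eventually.of_forall fun _ _ => h1
    · have h2 : h ∉ ⨅ i, N i := by rwa [hN.trivial, Subgroup.mem_bot]
      rw [Subgroup.mem_iInf, not_forall] at h2
      obtain ⟨i, hi⟩ := h2
      filter_upwards [eventually_ge_atTop i] with j hj hj'
      exact absurd (hN.anti hj hj') hi
  filter_upwards [hev] with i hi a g hg hess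
  by_contra! hlen
  have hq := hp.quotHom (N i)
  obtain ⟨x, rfl⟩ := hq.1.surj a
  obtain ⟨y, hy, hyx⟩ := hq.1.exists_endsAt hg
  obtain ⟨h, hh, rfl⟩ := Quotient.exact hyx.symm
  -- Conjugating by k moves the base point to one of finitely many representatives, where only
  -- finitely many elements have displacement at most n; normality keeps the conjugate in N i.
  obtain ⟨k, hk⟩ := hp.exists_deck (hσ (p.onV x))
  have h1 : k⁻¹ * h * k ∈ N i := by
    have := (hN.normal i).conj_mem h hh k⁻¹
    rwa [inv_inv] at this
  have h2 := hi (k⁻¹ * h * k) (Set.mem_iUnion.2 ⟨p.onV x, ?_⟩) h1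
  · refine hess ?_
    have h3 : h = 1 := by
      rw [mul_assoc, inv_mul_eq_one] at h2
      exact (mul_eq_right.1 h2.symm)
    rw [hq.nullHomotopic_iff]
    rw [h3] at hy
    exact hy
  · change K.vdist _ _ ≤ n
    rw [← hp.connected.deck_vdist k, ← deck_mul_apply k, hk, mul_assoc, mul_inv_cancel_left,
      deck_mul_apply, hk]
    obtain ⟨l, hl, rfl⟩ := hy
    rw [List.length_map] at hlen
    exact (vdist_le_length hl).trans hlen

end Quotients

/-! ### Clearing denominators, and norms of chains of loops -/

section Norms

variable {K : TwoComplex.{u}}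

theorem bd₂_apply (R : Type) [CommRing R] (A : K.TwoChain R) (e : K.E) :
    (K.bd₂ R A).1 e = A.sum fun f n => n * (K.pathChain R (K.bdry f)).1 e := by
  rw [bd₂, Finsupp.linearCombination_apply, Finsupp.sum, Finsupp.sum, AddSubmonoidClass.coe_finsetSum]
  simp [Finsupp.finsetSum_apply]

theorem pathChain_apply_cast (l : List K.E) (e : K.E) :
    (((K.pathChain ℤ l).1 e : ℤ) : ℚ) = (K.pathChain ℚ l).1 e := by
  classical
  induction l with
  | nil => simp [pathChain]
  | cons e' l ih =>
    have h : ∀ (R : Type) [CommRing R], (K.pathChain R (e' :: l)).1 e =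
        ((if e' = e then 1 else 0) - (if K.rev e' = e then 1 else 0)) + (K.pathChain R l).1 e := by
      intro R _
      rw [pathChain, List.map_cons, List.sum_cons, ← pathChain, Submodule.coe_add,
        Finsupp.add_apply]
      congr 1
      change (Finsupp.single e' 1 - Finsupp.single (K.rev e') 1 : K.E →₀ R) e = _
      rw [Finsupp.sub_apply, Finsupp.single_apply, Finsupp.single_apply]
    rw [h, h, ← ih]
    push_cast
    rfl

theorem RationallyNull.exists_zsmul_eq_bd₂ {g : List K.E} (hg : K.RationallyNull g) :
    ∃ m : ℤ, m ≠ 0 ∧ ∃ A : K.TwoChain ℤ, K.bd₂ ℤ A = m • K.pathChain ℤ g := by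
  classical
  obtain ⟨B, hB⟩ := hg
  obtain ⟨b, hb⟩ := IsLocalization.exist_integer_multiples_of_finset (nonZeroDivisors ℤ)
    (B.support.image B)
  -- The multiples by the common denominator b are integers, so the floor changes nothing.
  refine ⟨b, nonZeroDivisors.ne_zero b.2, B.mapRange (fun q => ⌊(b : ℤ) • q⌋) (by simp), ?_⟩
  refine Subtype.ext (Finsupp.ext fun e => ?_)
  have h1 := congrArg (fun c : K.OneChain ℚ => ((b : ℤ) : ℚ) * c.1 e) hB
  rw [bd₂_apply, ← pathChain_apply_cast] at h1
  have h2 := bd₂_apply ℤ (B.mapRange (fun q => ⌊(b : ℤ) • q⌋) (by simp)) e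
  rw [Finsupp.sum_mapRange_index (by simp)] at h2
  rw [h2, Submodule.coe_smul, Finsupp.smul_apply, smul_eq_mul, ← Int.cast_inj (α := ℚ),
    Int.cast_mul, ← h1, Finsupp.sum, Finsupp.sum, Int.cast_sum, Finset.mul_sum]
  refine Finset.sum_congr rfl fun f hf => ?_
  obtain ⟨z, hz⟩ := hb (B f) (Finset.mem_image_of_mem _ hf)
  rw [Int.cast_mul, pathChain_apply_cast, ← hz, ← mul_assoc]
  congr 1

/-- The sum of the absolute values of the coefficients. -/
noncomputable def sumNatAbs {α : Type u} (c : α →₀ ℤ) : ℕ := c.sum fun _ n => n.natAbs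

theorem sumNatAbs_add_le {α : Type u} (c c' : α →₀ ℤ) :
    sumNatAbs (c + c') ≤ sumNatAbs c + sumNatAbs c' := by
  classical
  have h : ∀ (x : α →₀ ℤ), x.support ⊆ c.support ∪ c'.support →
      sumNatAbs x = ∑ e ∈ c.support ∪ c'.support, (x e).natAbs := fun x hx =>
    Finsupp.sum_of_support_subset _ hx _ (by simp)
  rw [h _ Finsupp.support_add, h c Finset.subset_union_left, h c' Finset.subset_union_right,
    ← Finset.sum_add_distrib]
  exact Finset.sum_le_sum fun e _ => Int.natAbs_add_le _ _

theorem sumNatAbs_smul_le {α : Type u} (m : ℤ) (c : α →₀ ℤ) :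
    sumNatAbs (m • c) ≤ m.natAbs * sumNatAbs c := by
  rw [sumNatAbs, Finsupp.sum_of_support_subset _ (Finsupp.support_smul) _ (by simp), sumNatAbs,
    Finsupp.sum, Finset.mul_sum]
  exact Finset.sum_le_sum fun e _ => by simp [Int.natAbs_mul]

theorem sumNatAbs_pathChain_le (l : List K.E) :
    sumNatAbs (K.pathChain ℤ l).1 ≤ 2 * l.length := by
  induction l with
  | nil => simp [pathChain, sumNatAbs]
  | cons e l ih =>
    rw [pathChain, List.map_cons, List.sum_cons, ← pathChain, Submodule.coe_add, List.length_cons]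
    refine (sumNatAbs_add_le _ _).trans ?_
    have h1 : sumNatAbs (K.edgeChain ℤ e).1 ≤ 1 + 1 := by
      change sumNatAbs (Finsupp.single e 1 - Finsupp.single (K.rev e) 1 : K.E →₀ ℤ) ≤ _
      rw [sub_eq_add_neg, ← Finsupp.single_neg]
      refine (sumNatAbs_add_le _ _).trans (Nat.add_le_add ?_ ?_) <;>
      · rw [sumNatAbs, Finsupp.sum_single_index (by simp)]
        simp
    omega

theorem norm₁_zsmul_pathChain_le (m : ℤ) (l : List K.E) :
    K.norm₁ (m • K.pathChain ℤ l) ≤ ENNReal.ofReal (|(m : ℝ)| * l.length) := by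
  have h1 : sumNatAbs (m • K.pathChain ℤ l).1 ≤ m.natAbs * l.length * 2 := by
    rw [Submodule.coe_smul]
    refine (sumNatAbs_smul_le m _).trans ?_
    rw [mul_assoc, mul_comm l.length]
    exact Nat.mul_le_mul_left _ (sumNatAbs_pathChain_le l)
  have h2 : |(m : ℝ)| * l.length = (m.natAbs * l.length : ℕ) := by
    rw [Nat.cast_mul, Nat.cast_natAbs, Int.cast_abs]
  rw [h2, ENNReal.ofReal_natCast, norm₁]
  refine ENNReal.div_le_of_le_mul ?_
  exact_mod_cast h1

end Norms

/-! ### The filling constant -/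

section Rho

variable {X M : TwoComplex.{u}} {p : Hom X M}

/-- Test the infimum on an integrally bounding multiple m g: its norm is at most |m| L, its filling
norm at least |m| D, and |m| cancels. -/
theorem rho_le_of_filling {a : M.V} {g : List M.E} (hp : p.IsUniversalCover)
    (hg : M.IsShortestEssential a g) (hnull : M.RationallyNull g) {D : ℝ} (hD : 0 < D)
    (hfill : ∀ (A : M.TwoChain ℤ) (m : ℤ), M.bd₂ ℤ A = m • M.pathChain ℤ g →
      |(m : ℝ)| * D ≤ M.norm₂ A) :
    M.rho ≤ ENNReal.ofReal (g.length / D) := by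
  unfold rho
  split_ifs with h
  · exact bot_le
  · obtain ⟨m, hm, A, hA⟩ := hnull.exists_zsmul_eq_bd₂
    obtain ⟨γ, hγ⟩ := hp.exists_isLift hg.isPath hg.length_pos
    have hm' : 0 < |(m : ℝ)| := abs_pos.2 (Int.cast_ne_zero.2 hm)
    have hne : m • M.pathChain ℤ g ≠ 0 := by
      intro h0
      have h1 := congrArg (coefficient (p.onE (γ 0))) h0
      rw [map_zsmul, hγ.coefficient_pathChain hg hp, map_zero, zsmul_eq_mul, mul_one] at h1
      exact hm (by exact_mod_cast h1)
    refine (iInf_le_of_le (m • M.pathChain ℤ g)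
      (iInf₂_le_of_le ⟨A, hA⟩ hne le_rfl)).trans ?_
    have hf : ENNReal.ofReal (|(m : ℝ)| * D) ≤ M.fill (m • M.pathChain ℤ g) := by
      refine le_iInf₂ fun A hA => ?_
      rw [← ENNReal.ofReal_natCast]
      exact ENNReal.ofReal_le_ofReal (hfill A m hA)
    refine (ENNReal.div_le_div (norm₁_zsmul_pathChain_le m g) hf).trans ?_
    rw [← ENNReal.ofReal_div_of_pos (by positivity), mul_div_mul_left _ _ hm'.ne']

theorem tendsto_length_div_exponential (C R₀ : ℝ) {δ : ℝ} (hδ : 0 < δ) {L : ℕ → ℕ}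
    (hL : Tendsto L atTop atTop) :
    Tendsto (fun i => (L i : ℝ) / (2 ^ (((((L i - 1) / 4 : ℕ) : ℝ) - R₀ - 1) / δ) / C)) atTop
      (𝓝 0) := by
  -- Since L ≤ 4(R + 1), the quotient is at most a constant times (R + 1) q^R, with q < 1.
  set q : ℝ := 2 ^ (-(1 / δ)) with hq
  have hq0 : 0 ≤ q := by positivity
  have hq1 : q < 1 := Real.rpow_lt_one_of_one_lt_of_neg one_lt_two (by simpa using hδ)
  have hR : Tendsto (fun i => (L i - 1) / 4) atTop atTop := by
    refine tendsto_atTop.2 fun n => ?_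
    filter_upwards [hL.eventually_ge_atTop (4 * n + 1)] with i hi
    omega
  have h1 := (tendsto_self_mul_const_pow_of_lt_one hq0 hq1).add
    (tendsto_pow_atTop_nhds_zero_of_lt_one hq0 hq1)
  have h2 := ((h1.comp hR).const_mul (4 * |C| * 2 ^ ((R₀ + 1) / δ)))
  simp only [add_zero, mul_zero] at h2
  refine squeeze_zero_norm (fun i => ?_) h2
  set R := (L i - 1) / 4 with hRi
  have hLR : (L i : ℝ) ≤ 4 * (R + 1) := by
    have : L i ≤ 4 * (R + 1) := by omega
    exact_mod_cast this
  have h3 : (2 : ℝ) ^ (((R : ℝ) - R₀ - 1) / δ) * (2 ^ ((R₀ + 1) / δ) * q ^ R) = 1 := by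
    rw [hq, ← Real.rpow_mul_natCast zero_le_two, ← Real.rpow_add two_pos, ← Real.rpow_add two_pos]
    convert Real.rpow_zero (2 : ℝ) using 2
    field_simp
    ring
  have h4 : (0 : ℝ) < 2 ^ (((R : ℝ) - R₀ - 1) / δ) := by positivity
  rw [Real.norm_eq_abs, div_div_eq_mul_div, abs_div, abs_mul, Nat.abs_cast, abs_of_pos h4,
    div_le_iff₀ h4]
  calc (L i : ℝ) * |C| ≤ 4 * (R + 1) * |C| := mul_le_mul_of_nonneg_right hLR (abs_nonneg _)
    _ = 4 * (R + 1) * |C| * (2 ^ (((R : ℝ) - R₀ - 1) / δ) * (2 ^ ((R₀ + 1) / δ) * q ^ R)) := by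
      rw [h3, mul_one]
    _ = _ := by
      simp only [Function.comp_apply, ← hRi]
      ring

/-- The filling constants tend to zero along residual chains. -/
theorem Hom.IsUniversalCover.tendsto_rho (hp : p.IsUniversalCover) (hM : M.IsFinite)
    (htf : M.TorsionFreePi1) {δ : ℝ} (hδ : 0 < δ) (hX : X.IsHyperbolic δ)
    {N : ℕ → Subgroup (deck p)} (hN : IsResidualChain N)
    (hnull : ∀ i, ∃ (a : (quot (N i)).V) (g : List (quot (N i)).E),
      (quot (N i)).IsShortestEssential a g ∧ (quot (N i)).RationallyNull g) :
    Tendsto (fun i => (quot (N i)).rho) atTop (𝓝 0) := by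
  choose a g hg hnull using hnull
  obtain ⟨C, R₀, hC, hfill⟩ := exists_filling_constants X hδ hX
  have hL : Tendsto (fun i => (g i).length) atTop atTop := by
    refine tendsto_atTop.2 fun n => ?_
    filter_upwards [hp.eventually_lt_length hM hN n] with i hi
    exact (hi _ _ (hg i).isPath (hg i).essential).le
  have h0 := ENNReal.tendsto_ofReal (tendsto_length_div_exponential C R₀ hδ hL)
  rw [ENNReal.ofReal_zero] at h0
  refine tendsto_of_tendsto_of_tendsto_of_le_of_le tendsto_const_nhds h0 (fun _ => bot_le)
    fun i => ?_
  have hq := hp.quotHom (N i)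
  refine rho_le_of_filling hq (hg i) (hnull i) (by positivity) fun A m hA => ?_
  obtain ⟨γ, hγ⟩ := hq.exists_isLift (hg i).isPath (hg i).length_pos
  -- With c = 0 the second alternative applies, so no lower bound on R is needed, even for small i.
  have h1 := hfill _ _ (hp.isFinite_quot hM (hN.normal i) (hN.finiteIndex i)) hq
    (hp.torsionFreePi1_quot htf (N i)) _ _ (hg i) γ hγ A m 0 (fun e he => absurd rfl he)
    (Or.inr fun _ _ => rfl) (by rw [hA, add_zero])
  rw [← mul_div_assoc, div_le_iff₀ hC, mul_comm _ C]
  exact h1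

end Rho

end TwoComplex

theorem mainTheorem8 (X : TwoComplex.{u}) :
    -- translates of the tube around a lift of a shortest essential loop are disjoint
    (∀ (M : TwoComplex.{u}) (p : TwoComplex.Hom X M), M.IsFinite → p.IsUniversalCover →
      M.TorsionFreePi1 →
      ∀ (a : M.V) (g : List M.E) (γ : ℤ → X.E), M.IsShortestEssential a g →
        TwoComplex.IsLift p g γ →
        ∃ τ : TwoComplex.deck p, (∀ n : ℤ, τ.1.2.1 (γ n) = γ (n + g.length)) ∧
          ∀ h : TwoComplex.deck p, h ∉ Subgroup.zpowers τ →
            Disjoint (h.1.1 '' TwoComplex.tubeV g γ) (TwoComplex.tubeV g γ)) ∧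
    -- fillings of multiples of a shortest essential loop are exponentially large,
    -- with constants depending only on the universal cover
    (∀ δ : ℝ, 0 < δ → X.IsHyperbolic δ → ∃ C R₀ : ℝ, 0 < C ∧
      ∀ (M : TwoComplex.{u}) (p : TwoComplex.Hom X M), M.IsFinite → p.IsUniversalCover →
        M.TorsionFreePi1 →
        ∀ (a : M.V) (g : List M.E), M.IsShortestEssential a g →
          (∀ (γ : ℤ → X.E), TwoComplex.IsLift p g γ →
            ∀ (A : M.TwoChain ℤ) (m : ℤ) (c : M.OneChain ℤ),
              (∀ f, A f ≠ 0 → f ∈ TwoComplex.tubeImageF p g γ) →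
              (∀ e, c.1 e ≠ 0 → e ∈ TwoComplex.tubeFrontier p g γ) →
              (R₀ ≤ ((g.length - 1) / 4 : ℕ) ∨ ∀ e ∈ g, c.1 e = 0) →
              M.bd₂ ℤ A = m • M.pathChain ℤ g + c →
              |(m : ℝ)| * 2 ^ (((((g.length - 1) / 4 : ℕ) : ℝ) - R₀ - 1) / δ) ≤ C * M.norm₂ A) ∧
          (∀ (A : M.TwoChain ℤ) (m : ℤ), M.bd₂ ℤ A = m • M.pathChain ℤ g →
              |(m : ℝ)| * 2 ^ (((((g.length - 1) / 4 : ℕ) : ℝ) - R₀ - 1) / δ) ≤ C * M.norm₂ A)) ∧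
    -- the filling constants tend to zero along residual chains
    (∀ (M : TwoComplex.{u}) (p : TwoComplex.Hom X M), M.IsFinite → p.IsUniversalCover →
      M.TorsionFreePi1 → (∃ δ : ℝ, 0 < δ ∧ X.IsHyperbolic δ) →
      ∀ N : ℕ → Subgroup (TwoComplex.deck p), TwoComplex.IsResidualChain N →
        (∀ i, ∃ (a : (TwoComplex.quot (N i)).V) (g : List (TwoComplex.quot (N i)).E),
          (TwoComplex.quot (N i)).IsShortestEssential a g ∧
          (TwoComplex.quot (N i)).RationallyNull g) →
        Tendsto (fun i => (TwoComplex.quot (N i)).rho) atTop (𝓝 0)) := by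
  refine ⟨?_, ?_, ?_⟩
  · intro M p _ hp _ a g γ hg hγ
    obtain ⟨τ, hτ⟩ := hγ.exists_translation hp
    refine ⟨τ, hτ, fun h hh => Set.disjoint_left.2 ?_⟩
    rintro _ ⟨x, hx, rfl⟩ hhx
    have hL := hg.length_pos
    exact hh (hγ.mem_zpowers hg hp hτ (r := (g.length - 1) / 4) (by omega) hx hhx)
  · intro δ hδ hX
    obtain ⟨C, R₀, hC, h⟩ := TwoComplex.exists_filling_constants X hδ hX
    refine ⟨C, R₀, hC, fun M p hM hp htf a g hg => ⟨fun γ hγ A m c _ hc hcg hA => ?_,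
      fun A m hA => ?_⟩⟩
    · exact h M p hM hp htf a g hg γ hγ A m c hc hcg hA
    · obtain ⟨γ, hγ⟩ := hp.exists_isLift hg.isPath hg.length_pos
      exact h M p hM hp htf a g hg γ hγ A m 0 (fun e he => absurd rfl he) (Or.inr fun _ _ => rfl)
        (by rw [hA, add_zero])
  · rintro M p hM hp htf ⟨δ, hδ, hX⟩ N hN hnull
    exact hp.tendsto_rho hM htf hδ hX hN hnull
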